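/- Let $p\neq 2$ be a prime and let $\Gamma=(V,L)$ be the Cayley tree of order two (a tree in which every vertex has exactly three neighbours) with root $x^0$; let $W_n$, $V_n$ be the sets of vertices at distance $n$, respectively at most $n$, from $x^0$. Let $q,m$ be integers with $1\le m\le [q/2]$, let $J\in\mathbb Q_p$ with $|J|_p<p^{-1/(p-1)}$, and let $\theta=\exp_p(J)$. For a field $\tilde h=(\tilde h_{i,x})_{1\le i\le q,\,x\in V}$ with $|\tilde h_{i,x}|_p<p^{-1/(p-1)}$ and $n\ge 1$ put $$\mu^{(n)}_{\tilde h}(\sigma)=Z_{n,\tilde h}^{-1}\exp_p\Big\{J\sum_{\langle x,y\rangle\subset V_n}\delta_{\sigma(x)\sigma(y)}+\sum_{x\in W_n}\tilde h_{\sigma(x),x}\Big\},\qquad \sigma\in\{1,\dots,q\}^{V_n},$$ where $Z_{n,\tilde h}$ is the normalizing factor. If all $Z_{n,\tilde h}$, $n\ge1$, are nonzero and the distributions are compatible, i.e. $\sum_{\omega\in\{1,\dots,q\}^{W_{n+1}}}\mu^{(n+1)}_{\tilde h}(\sigma\vee\omega)=\mu^{(n)}_{\tilde h}(\sigma)$ for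 all $n\ge1$ and $\sigma\in\{1,\dots,q\}^{V_n}$, the finitely additive $\mathbb Q_p$-valued probability measure on the algebra of cylinder sets of $\{1,\dots,q\}^V$ with $\mu(\{\tau:\tau|_{V_n}=\sigma\})=\mu^{(n)}_{\tilde h}(\sigma)$ for all $n\ge 1$ and $\sigma$ is the $p$-adic Gibbs measure of the Potts model corresponding to $\tilde h$. It is translation-invariant (a TIpGM) if $\tilde h_{i,x}-\tilde h_{j,x}$ does not depend on $x$. A TIpGM *belongs to $m$* if it corresponds to some such $\tilde h$ of the form $\tilde h_{i,x}=c_x+a\,\mathbf 1_M(i)$ with $a\ne0$ and $M\subset\{1,\dots,q\}$, $|M|=m$. Put $D=(\theta-1)^2-4m(q-m)$ and consider the conditions 1a) $|m|_p>\max\{|\theta-1|_p,|q|_p\}$ and $\theta\notin\{1,1-q,1+q\}$; 1b) $|m|_p=|\theta-1|_p=|q|_p$, $0<|(\theta-1)^2-q^2|_p<|q^2|_p$, $0<|q-2m|_p<|q|_p$, $D\ne0$ and $\sqrt D$ exists in $\mathbb Q_p$; 2a) $|m|_p>\max\{|\theta-1|_p,|q|_p\}$ and $\theta\in\{1-q,1+q\}$;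 2b) $|m|_p<|\theta-1|_p=|q|_p$ and $0<|(\theta-1)^2-q^2|_p<|q^2|_p$; 2c) $|m|_p=|\theta-1|_p=|q|_p$, $0<|(\theta-1)^2-q^2|_p<|q^2|_p$ and $|q-2m|_p=|q|_p$; 2d) $|m|_p=|\theta-1|_p=|q|_p$, $\theta\in\{1-q,1+q\}$ and $0<|q-2m|_p<|q|_p$; 2e) $q=2m$, $|\theta-1|_p=|q|_p$, $0<|(\theta-1)^2-q^2|_p<|q^2|_p$ and $\sqrt{(\theta-1)^2-q^2}$ exists in $\mathbb Q_p$; 2f) $|m|_p=|\theta-1|_p=|q|_p$, $0<|(\theta-1)^2-q^2|_p<|q^2|_p$, $0<|q-2m|_p<|q|_p$ and $D=0$. 1) If 1a or 1b holds, there are exactly $2\binom qm$ TIpGMs that belong to $m$, except when $(\theta-1)^3=m(q-m)(3(\theta-1)-q)$, in which case there are exactly $\binom qm$. 2) If one of 2a–2f holds, there are exactly $\binom qm$ TIpGMs that belong to $m$. 3) Otherwise there is no TIpGM that belongs to $m$. -/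

import Mathlib

/-!
The `q`-state `p`-adic Potts model on a Cayley tree, its `p`-adic Gibbs measures, and the
parameter conditions of the classification of the translation-invariant ones.

The Cayley tree is a graph `G` on `V` (a regular tree), `x₀ : V` is its root, and the spin space
is `Fin q`.
-/

namespace PadicPotts

/-- The number `p ^ (-1 / (p - 1))`: the `p`-adic exponential series converges exactly on the open
ball of this radius around `0`. -/
noncomputable def expRadius (p : ℕ) : ℝ := (p : ℝ) ^ (-1 / ((p : ℝ) - 1))

section Measure

variable (p : ℕ) [Fact p.Prime] {X : Type*}

/-- A `p`-adic measure on a collection `𝓑` of subsets of `X` (an algebra of sets, in the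
application): a finitely additive function `𝓑 → ℚ_p`. -/
@[ext]
structure PadicMeasure (𝓑 : Set (Set X)) where
  /-- The value of the measure on a member of `𝓑`. -/
  toFun : 𝓑 → ℚ_[p]
  additive : ∀ (n : ℕ) (A : Fin n → 𝓑) (U : 𝓑),
    (∀ i j, i ≠ j → Disjoint (A i : Set X) (A j : Set X)) → (U : Set X) = ⋃ j, (A j : Set X) →
      toFun U = ∑ j, toFun (A j)

end Measure

section Tree

variable {V : Type*} (G : SimpleGraph V) (x₀ : V)

/-- `W_n`: the vertices at distance `n` from the root. -/
def sphere (n : ℕ) : Set V := {x | G.dist x₀ x = n}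

/-- `V_n`: the vertices at distance at most `n` from the root. -/
def ball (n : ℕ) : Set V := {x | G.dist x₀ x ≤ n}

theorem sphere_subset_ball (n : ℕ) : sphere G x₀ n ⊆ ball G x₀ n :=
  fun _ hx => le_of_eq hx

theorem mem_sphere_of_not_mem_ball {n : ℕ} {x : V} (hx : x ∈ ball G x₀ (n + 1))
    (h : x ∉ ball G x₀ n) : x ∈ sphere G x₀ (n + 1) :=
  le_antisymm hx (Nat.succ_le_of_lt (Nat.lt_of_not_le h))

open Classical in
/-- The concatenation `σ ∨ ω` of a configuration `σ` on `V_n` and a configuration `ω` on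
`W_{n+1}`. -/
noncomputable def concat {q n : ℕ} (σ : ball G x₀ n → Fin q) (ω : sphere G x₀ (n + 1) → Fin q) :
    ball G x₀ (n + 1) → Fin q :=
  fun x => if h : (x : V) ∈ ball G x₀ n then σ ⟨x, h⟩
    else ω ⟨x, mem_sphere_of_not_mem_ball G x₀ x.2 h⟩

/-- The algebra of cylinder subsets of the configuration space `Ω = Φ^V`: the sets that are
determined by finitely many coordinates. -/
def cylinders (V : Type*) (q : ℕ) : Set (Set (V → Fin q)) :=
  {A | ∃ (s : Finset V) (S : Set (s → Fin q)), A = {τ | (fun x : s => τ x) ∈ S}}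

/-- The event that the configuration agrees with `σ` on `V_n`. -/
def cylinderOf {q n : ℕ} (σ : ball G x₀ n → Fin q) : Set (V → Fin q) :=
  {τ | ∀ x : ball G x₀ n, τ x = σ x}

end Tree

section Potts

variable {p : ℕ} [Fact p.Prime] {V : Type*} (G : SimpleGraph V) (x₀ : V) {q : ℕ}

open Classical in
/-- The Potts Hamiltonian restricted to `V_n`: `J` times the sum, over the edges `⟨x, y⟩` with both
ends in `V_n`, of the Kronecker symbol of `σ x` and `σ y`. -/
noncomputable def hamiltonian (J : ℚ_[p]) {n : ℕ} (σ : ball G x₀ n → Fin q) : ℚ_[p] :=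
  J * ∑ᶠ e : (G.induce (ball G x₀ n)).edgeSet,
    if (Sym2.map σ (e : Sym2 (ball G x₀ n))).IsDiag then 1 else 0

/-- The unnormalized weight `exp_p (H_n(σ) + ∑_{x ∈ W_n} h_{σ(x),x})`. -/
noncomputable def weight (J : ℚ_[p]) (h : V → Fin q → ℚ_[p]) {n : ℕ} (σ : ball G x₀ n → Fin q) :
    ℚ_[p] :=
  NormedSpace.exp (hamiltonian G x₀ J σ +
    ∑ᶠ x : sphere G x₀ n, h x (σ ⟨x, sphere_subset_ball G x₀ n x.2⟩))

/-- The normalizing factor `Z_n`. -/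
noncomputable def partitionFunction (J : ℚ_[p]) (h : V → Fin q → ℚ_[p]) (n : ℕ) : ℚ_[p] :=
  ∑ᶠ σ : ball G x₀ n → Fin q, weight G x₀ J h σ

/-- The finite-dimensional distribution `μ^{(n)}` on the configurations on `V_n`. -/
noncomputable def finiteDistribution (J : ℚ_[p]) (h : V → Fin q → ℚ_[p]) {n : ℕ}
    (σ : ball G x₀ n → Fin q) : ℚ_[p] :=
  (partitionFunction G x₀ J h n)⁻¹ * weight G x₀ J h σ

/-- `μ` is the `p`-adic Gibbs measure of the Potts model with coupling constant `J` that
corresponds to the boundary field `h`: the field lies in the domain of `exp_p`, the distributions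
`μ^{(n)}`, `n ≥ 1`, are well defined and compatible, and `μ` is the probability measure on the
cylinder algebra that extends them. -/
structure IsGibbsMeasure (J : ℚ_[p]) (h : V → Fin q → ℚ_[p])
    (μ : PadicMeasure p (cylinders V q)) : Prop where
  field_mem : ∀ x i, ‖h x i‖ < expRadius p
  normalizable : ∀ n, 1 ≤ n → partitionFunction G x₀ J h n ≠ 0
  compatible : ∀ n, 1 ≤ n → ∀ σ : ball G x₀ n → Fin q,
    ∑ᶠ ω : sphere G x₀ (n + 1) → Fin q, finiteDistribution G x₀ J h (concat G x₀ σ ω) =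
      finiteDistribution G x₀ J h σ
  prob : ∀ A : cylinders V q, (A : Set (V → Fin q)) = Set.univ → μ.toFun A = 1
  extends_distribution : ∀ n, 1 ≤ n → ∀ (σ : ball G x₀ n → Fin q) (A : cylinders V q),
    (A : Set (V → Fin q)) = cylinderOf G x₀ σ → μ.toFun A = finiteDistribution G x₀ J h σ

/-- A boundary field is translation-invariant if the reduced field `h_{i,x} - h_{j,x}` does not
depend on the vertex `x`. -/
def IsTranslationInvariant (h : V → Fin q → ℚ_[p]) : Prop :=
  ∀ x y i j, h x i - h x j = h y i - h y j

/-- The boundary field is, up to adding the same number to all its components at a vertex, equal to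
`a • 1_M` for a number `a ≠ 0` and a set `M` of `m` spin values. -/
def IsSupportedOn (m : ℕ) (h : V → Fin q → ℚ_[p]) : Prop :=
  ∃ M : Finset (Fin q), M.card = m ∧ ∃ a : ℚ_[p], a ≠ 0 ∧ ∃ c : V → ℚ_[p],
    ∀ x i, h x i = c x + if i ∈ M then a else 0

/-- The translation-invariant `p`-adic Gibbs measures of the `q`-state Potts model that belong to a
given `m`. -/
def tiGibbsMeasures (J : ℚ_[p]) (q m : ℕ) : Set (PadicMeasure p (cylinders V q)) :=
  {μ | ∃ h : V → Fin q → ℚ_[p], IsTranslationInvariant h ∧ IsSupportedOn m h ∧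
    IsGibbsMeasure G x₀ J h μ}

end Potts

section Conditions

variable {p : ℕ} [Fact p.Prime]

/-- `θ ∈ {1 - q, 1 + q}`. -/
def IsSpecial (θ : ℚ_[p]) (q : ℕ) : Prop := θ = 1 - q ∨ θ = 1 + q

/-- `0 < |(θ - 1)² - q²|_p < |q²|_p`. -/
def IsClose (θ : ℚ_[p]) (q : ℕ) : Prop :=
  0 < ‖(θ - 1) ^ 2 - (q : ℚ_[p]) ^ 2‖ ∧ ‖(θ - 1) ^ 2 - (q : ℚ_[p]) ^ 2‖ < ‖(q : ℚ_[p]) ^ 2‖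

/-- The discriminant `(θ - 1)² - 4 m (q - m)`. -/
noncomputable def disc (θ : ℚ_[p]) (q m : ℕ) : ℚ_[p] := (θ - 1) ^ 2 - 4 * m * (q - m)

/-- `|m|_p = |θ - 1|_p = |q|_p`. -/
def AllEqual (θ : ℚ_[p]) (q m : ℕ) : Prop :=
  ‖(m : ℚ_[p])‖ = ‖θ - 1‖ ∧ ‖θ - 1‖ = ‖(q : ℚ_[p])‖

def Cond1a (θ : ℚ_[p]) (q m : ℕ) : Prop :=
  max ‖θ - 1‖ ‖(q : ℚ_[p])‖ < ‖(m : ℚ_[p])‖ ∧ ¬ IsSpecial θ q ∧ θ ≠ 1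

def Cond1b (θ : ℚ_[p]) (q m : ℕ) : Prop :=
  AllEqual θ q m ∧ IsClose θ q ∧
    (0 < ‖(q : ℚ_[p]) - 2 * m‖ ∧ ‖(q : ℚ_[p]) - 2 * m‖ < ‖(q : ℚ_[p])‖) ∧
    disc θ q m ≠ 0 ∧ IsSquare (disc θ q m)

def Cond2a (θ : ℚ_[p]) (q m : ℕ) : Prop :=
  max ‖θ - 1‖ ‖(q : ℚ_[p])‖ < ‖(m : ℚ_[p])‖ ∧ IsSpecial θ q

def Cond2b (θ : ℚ_[p]) (q m : ℕ) : Prop :=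
  (‖(m : ℚ_[p])‖ < ‖θ - 1‖ ∧ ‖θ - 1‖ = ‖(q : ℚ_[p])‖) ∧ IsClose θ q

def Cond2c (θ : ℚ_[p]) (q m : ℕ) : Prop :=
  AllEqual θ q m ∧ IsClose θ q ∧ ‖(q : ℚ_[p]) - 2 * m‖ = ‖(q : ℚ_[p])‖

def Cond2d (θ : ℚ_[p]) (q m : ℕ) : Prop :=
  AllEqual θ q m ∧ IsSpecial θ q ∧
    (0 < ‖(q : ℚ_[p]) - 2 * m‖ ∧ ‖(q : ℚ_[p]) - 2 * m‖ < ‖(q : ℚ_[p])‖)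

def Cond2e (θ : ℚ_[p]) (q m : ℕ) : Prop :=
  q = 2 * m ∧ ‖θ - 1‖ = ‖(q : ℚ_[p])‖ ∧ IsClose θ q ∧ IsSquare ((θ - 1) ^ 2 - (q : ℚ_[p]) ^ 2)

/-- The case of a vanishing discriminant (a double root of the fixed point equation). -/
def Cond2f (θ : ℚ_[p]) (q m : ℕ) : Prop :=
  AllEqual θ q m ∧ IsClose θ q ∧
    (0 < ‖(q : ℚ_[p]) - 2 * m‖ ∧ ‖(q : ℚ_[p]) - 2 * m‖ < ‖(q : ℚ_[p])‖) ∧ disc θ q m = 0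

/-- Condition 1: `1a` or `1b`. -/
def Cond1 (θ : ℚ_[p]) (q m : ℕ) : Prop := Cond1a θ q m ∨ Cond1b θ q m

/-- Condition 2: one of `2a`, ..., `2f`. -/
def Cond2 (θ : ℚ_[p]) (q m : ℕ) : Prop :=
  Cond2a θ q m ∨ Cond2b θ q m ∨ Cond2c θ q m ∨ Cond2d θ q m ∨ Cond2e θ q m ∨ Cond2f θ q m

/-- The exceptional values of `θ`: under condition 1 this equation says that the normalizing factors
vanish for one of the two solutions of the fixed point equation. -/
def IsExceptional (θ : ℚ_[p]) (q m : ℕ) : Prop :=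
  (θ - 1) ^ 3 = m * (q - m) * (3 * (θ - 1) - q)

end Conditions

end PadicPotts

/-! For p ≠ 2 the domain of `exp_p` is the open unit ball, which `exp_p` maps isometrically onto the
ball |z - 1| < 1, so boundary fields may be replaced by their exponentials. Adding c_x to the field
at x rescales all weights by a common constant; only a·1_M matters. Put z = exp a, ζ_i =
exp(a·1_M(i)), t = θ - 1.

Given the spins on V_n, those on W_{n+1} are independent, and a vertex of W_n, n ≥ 1, has two
children. Summing out W_{n+1} thus produces the factor `branch`² at each vertex of W_n, and
compatibility means that `branch`² is proportional to ζ. If s is the ratio of the two values of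
`branch`, then z = s², and division by s - 1 leaves m s² - t s + (q - m) = 0. The root has three
children, so Z_1 is a nonzero multiple of m s³ + (q - m), and every Z_{n+1} is a nonzero multiple of
Z_n. The measures therefore come from pairs (M, s) with s in `admissiblePoints`
(`mem_tiGibbsMeasures_iff`, `exists_represents`).

A measure determines (M, s) up to passing to (Mᶜ, s') with s² s'² = 1 (`Represents.eq_or_compl`). If
q ≠ 2m this changes the size of M, and the number of measures is binom(q, m) times the number of
admissible s. If q = 2m the two roots are mutually inverse, complementation exchanges them, and
binom(q, m) measures remain.

To count, write s = ±(1 + v) with |v| < 1; then m v² + (2m ∓ t) v + (q ∓ t) = 0. The dominant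
coefficient decides: constant, no small root; linear, exactly one by Hensel; leading, as many as the
discriminant allows. Finally, modulo the quadratic the equation m s³ + (q - m) = 0 is linear in s,
and eliminating s gives the exceptional equation: it removes one of the two roots under condition 1
and none under condition 2. -/

namespace PadicPotts

/-! ### The p-adic exponential for odd p -/

section Exponential

variable {p : ℕ} [hpp : Fact p.Prime]

theorem two_lt_of_ne_two (hp : p ≠ 2) : 2 < p :=
  lt_of_le_of_ne hpp.out.two_le (Ne.symm hp)

theorem norm_le_inv_of_norm_lt_one {x : ℚ_[p]} (hx : ‖x‖ < 1) : ‖x‖ ≤ (p : ℝ)⁻¹ := by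
  have := (Padic.norm_le_pow_iff_norm_lt_pow_add_one x (-1)).2 (by simpa using hx)
  simpa using this

theorem norm_two_eq_one (hp : p ≠ 2) : ‖(2 : ℚ_[p])‖ = 1 := by
  have h : ¬ ((p : ℤ) ∣ 2) := by
    intro h
    have := Int.le_of_dvd (by norm_num) h
    have := two_lt_of_ne_two hp
    omega
  have h2 := (Padic.norm_intCast_lt_one_iff (p := p) (k := 2)).not.2 h
  have h3 := Padic.norm_int_le_one (p := p) 2
  push_cast at h2 h3
  exact le_antisymm h3 (not_lt.1 h2)

/-- Norms are powers of p, so norm less than 1 means norm at most 1/p, and 1/p < p^(-1/(p-1)) as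
soon as p > 2. -/
theorem norm_lt_expRadius_iff (hp : p ≠ 2) {x : ℚ_[p]} : ‖x‖ < expRadius p ↔ ‖x‖ < 1 := by
  have h2 : (2 : ℝ) < p := by exact_mod_cast two_lt_of_ne_two hp
  constructor
  · intro h
    refine h.trans_le (Real.rpow_le_one_of_one_le_of_nonpos (by linarith) ?_)
    exact div_nonpos_of_nonpos_of_nonneg (by norm_num) (by linarith)
  · intro h
    refine (norm_le_inv_of_norm_lt_one h).trans_lt ?_
    rw [expRadius, ← Real.rpow_neg_one]
    refine Real.rpow_lt_rpow_of_exponent_lt (by linarith) ?_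
    rw [lt_div_iff₀ (by linarith)]
    linarith

/-- Legendre's bound with p - 1 weakened to 2, which suffices for all estimates on the exponential
series. -/
theorem two_mul_padicValNat_factorial_lt (hp : p ≠ 2) {n : ℕ} (hn : n ≠ 0) :
    2 * padicValNat p n.factorial < n := by
  refine lt_of_le_of_lt ?_ (sub_one_mul_padicValNat_factorial_lt_of_ne_zero (p := p) hn)
  exact Nat.mul_le_mul_right _ (by have := two_lt_of_ne_two hp; omega)

theorem norm_inv_natCast {n : ℕ} (hn : n ≠ 0) :
    ‖((n : ℚ_[p]))⁻¹‖ = (p : ℝ) ^ padicValNat p n := by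
  rw [norm_inv, Padic.norm_eq_zpow_neg_valuation (by exact_mod_cast hn), Padic.valuation_natCast,
    zpow_neg, inv_inv, zpow_natCast]

theorem inv_sqrt_le_radius_expSeries (hp : p ≠ 2) :
    ENNReal.ofReal (√p)⁻¹ ≤ (NormedSpace.expSeries ℚ_[p] ℚ_[p]).radius := by
  have hp0 : (0 : ℝ) < p := by exact_mod_cast hpp.out.pos
  refine FormalMultilinearSeries.le_radius_of_bound _ 1 (r := (√p)⁻¹.toNNReal) fun n => ?_
  rw [Real.coe_toNNReal _ (by positivity), NormedSpace.expSeries, norm_smul,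
    ContinuousMultilinearMap.norm_mkPiAlgebraFin, mul_one, norm_inv_natCast n.factorial_ne_zero,
    inv_pow, ← div_eq_mul_inv, div_le_one (by positivity)]
  have h : 2 * padicValNat p n.factorial ≤ n := by
    rcases eq_or_ne n 0 with rfl | hn
    · simp
    · exact (two_mul_padicValNat_factorial_lt hp hn).le
  calc (p : ℝ) ^ padicValNat p n.factorial = √p ^ (2 * padicValNat p n.factorial) := by
        rw [pow_mul, Real.sq_sqrt hp0.le]
    _ ≤ √p ^ n := pow_le_pow_right₀ (by
        rw [Real.one_le_sqrt]; exact_mod_cast hpp.out.one_le) h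

theorem mem_ball_radius_expSeries (hp : p ≠ 2) {x : ℚ_[p]} (hx : ‖x‖ < 1) :
    x ∈ Metric.eball (0 : ℚ_[p]) (NormedSpace.expSeries ℚ_[p] ℚ_[p]).radius := by
  refine Metric.eball_subset_eball (inv_sqrt_le_radius_expSeries hp) ?_
  have hp1 : (1 : ℝ) < p := by exact_mod_cast hpp.out.one_lt
  rw [Metric.eball_ofReal, mem_ball_zero_iff]
  refine (norm_le_inv_of_norm_lt_one hx).trans_lt ?_
  rw [inv_lt_inv₀ (by linarith) (by positivity), Real.sqrt_lt' (by linarith)]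
  nlinarith

theorem exp_add (hp : p ≠ 2) {x y : ℚ_[p]} (hx : ‖x‖ < 1) (hy : ‖y‖ < 1) :
    NormedSpace.exp (x + y) = NormedSpace.exp x * NormedSpace.exp y :=
  NormedSpace.exp_add_of_mem_ball (𝕂 := ℚ_[p]) (mem_ball_radius_expSeries hp hx)
    (mem_ball_radius_expSeries hp hy)

theorem norm_sum_lt_one {ι : Type*} (s : Finset ι) (f : ι → ℚ_[p]) (hf : ∀ i ∈ s, ‖f i‖ < 1) :
    ‖∑ i ∈ s, f i‖ < 1 := by
  have hp0 : (0 : ℝ) < p := by exact_mod_cast hpp.out.pos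
  refine (IsUltrametricDist.norm_sum_le_of_forall_le_of_nonneg (C := (p : ℝ)⁻¹) (by positivity)
    fun i hi => norm_le_inv_of_norm_lt_one (hf i hi)).trans_lt ?_
  exact inv_lt_one_of_one_lt₀ (by exact_mod_cast hpp.out.one_lt)

theorem exp_sum (hp : p ≠ 2) {ι : Type*} (s : Finset ι) (f : ι → ℚ_[p])
    (hf : ∀ i ∈ s, ‖f i‖ < 1) :
    NormedSpace.exp (∑ i ∈ s, f i) = ∏ i ∈ s, NormedSpace.exp (f i) := by
  classical
  induction s using Finset.induction_on with
  | empty => simp [NormedSpace.exp_zero]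
  | insert a s ha ih =>
    have h : ∀ i ∈ s, ‖f i‖ < 1 := fun i hi => hf i (Finset.mem_insert_of_mem hi)
    rw [Finset.sum_insert ha, Finset.prod_insert ha, ← ih h,
      exp_add hp (hf a (Finset.mem_insert_self _ _)) (norm_sum_lt_one s f h)]

theorem norm_pow_div_factorial_le (hp : p ≠ 2) {d : ℚ_[p]} (hd : ‖d‖ < 1) (i : ℕ) :
    ‖d ^ (i + 2) / ((i + 2).factorial : ℚ_[p])‖ ≤ ‖d‖ * (p : ℝ)⁻¹ := by
  have hp0 : (0 : ℝ) < p := by exact_mod_cast hpp.out.pos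
  have hv : padicValNat p (i + 2).factorial ≤ i := by
    have := two_mul_padicValNat_factorial_lt hp (n := i + 2) (by omega)
    omega
  rw [div_eq_mul_inv, norm_mul, norm_inv_natCast (Nat.factorial_ne_zero _), norm_pow, pow_succ',
    mul_assoc]
  refine mul_le_mul_of_nonneg_left ?_ (norm_nonneg _)
  calc ‖d‖ ^ (i + 1) * (p : ℝ) ^ padicValNat p (i + 2).factorial
      ≤ (p : ℝ)⁻¹ ^ (i + 1) * (p : ℝ) ^ i := by
        gcongr
        · exact norm_le_inv_of_norm_lt_one hd
        · exact_mod_cast hpp.out.one_le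
    _ = (p : ℝ)⁻¹ := by
        rw [pow_succ, mul_right_comm, ← mul_pow, inv_mul_cancel₀ hp0.ne', one_pow, one_mul]

/-- Every term of degree at least 2 is smaller than the linear one by a factor 1/p. Both the
isometry property and surjectivity rest on this. -/
theorem norm_exp_sub_one_sub_le (hp : p ≠ 2) {d : ℚ_[p]} (hd : ‖d‖ < 1) :
    ‖NormedSpace.exp d - 1 - d‖ ≤ ‖d‖ * (p : ℝ)⁻¹ := by
  have hp0 : (0 : ℝ) < p := by exact_mod_cast hpp.out.pos
  have h := (NormedSpace.expSeries_div_hasSum_exp_of_mem_ball ℚ_[p] d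
    (mem_ball_radius_expSeries hp hd)).tendsto_sum_nat
  have h2 := ((h.comp (Filter.tendsto_add_atTop_nat 2)).sub_const (1 + d)).norm
  rw [sub_sub]
  refine le_of_tendsto h2 (Filter.Eventually.of_forall fun n => ?_)
  simp only [Function.comp]
  have h3 : ∑ i ∈ Finset.range (n + 2), d ^ i / (i.factorial : ℚ_[p]) - (1 + d) =
      ∑ i ∈ Finset.range n, d ^ (i + 2) / ((i + 2).factorial : ℚ_[p]) := by
    rw [Finset.sum_range_succ', Finset.sum_range_succ']
    simp
    ring
  rw [h3]
  exact IsUltrametricDist.norm_sum_le_of_forall_le_of_nonneg (by positivity)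
    fun i _ => norm_pow_div_factorial_le hp hd i

theorem norm_exp_sub_one (hp : p ≠ 2) {d : ℚ_[p]} (hd : ‖d‖ < 1) :
    ‖NormedSpace.exp d - 1‖ = ‖d‖ := by
  rcases eq_or_ne d 0 with rfl | h0
  · simp [NormedSpace.exp_zero]
  have h1 : ‖NormedSpace.exp d - 1 - d‖ < ‖d‖ := by
    refine (norm_exp_sub_one_sub_le hp hd).trans_lt (mul_lt_of_lt_one_right (norm_pos_iff.2 h0) ?_)
    exact inv_lt_one_of_one_lt₀ (by exact_mod_cast hpp.out.one_lt)
  have := IsUltrametricDist.norm_add_eq_max_of_norm_ne_norm h1.ne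
  rw [sub_add_cancel, max_eq_right h1.le] at this
  exact this

theorem norm_eq_one_of_norm_sub_one_lt {z : ℚ_[p]} (hz : ‖z - 1‖ < 1) : ‖z‖ = 1 := by
  have := IsUltrametricDist.norm_add_eq_max_of_norm_ne_norm (x := z - 1) (y := 1)
    (by rw [norm_one]; exact hz.ne)
  rwa [sub_add_cancel, norm_one, max_eq_right hz.le] at this

theorem ne_zero_of_norm_sub_one_lt {z : ℚ_[p]} (hz : ‖z - 1‖ < 1) : z ≠ 0 := by
  rw [← norm_ne_zero_iff, norm_eq_one_of_norm_sub_one_lt hz]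
  exact one_ne_zero

theorem exp_ne_zero (hp : p ≠ 2) {d : ℚ_[p]} (hd : ‖d‖ < 1) : NormedSpace.exp d ≠ 0 :=
  ne_zero_of_norm_sub_one_lt (by rwa [norm_exp_sub_one hp hd])

theorem norm_add_lt_one {x y : ℚ_[p]} (hx : ‖x‖ < 1) (hy : ‖y‖ < 1) : ‖x + y‖ < 1 :=
  (IsUltrametricDist.norm_add_le_max x y).trans_lt (max_lt hx hy)

theorem norm_sub_lt_one {x y : ℚ_[p]} (hx : ‖x‖ < 1) (hy : ‖y‖ < 1) : ‖x - y‖ < 1 := by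
  rw [sub_eq_add_neg]
  exact norm_add_lt_one hx (by rwa [norm_neg])

theorem exp_injOn (hp : p ≠ 2) {x y : ℚ_[p]} (hx : ‖x‖ < 1) (hy : ‖y‖ < 1)
    (h : NormedSpace.exp x = NormedSpace.exp y) : x = y := by
  have hd := norm_sub_lt_one hx hy
  have h1 := exp_add hp hd hy
  rw [sub_add_cancel, h, eq_comm, mul_eq_right₀ (exp_ne_zero hp hy)] at h1
  have h2 := norm_exp_sub_one hp hd
  rw [h1, sub_self, norm_zero, eq_comm, norm_eq_zero, sub_eq_zero] at h2
  exact h2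

theorem exp_neg (hp : p ≠ 2) {x : ℚ_[p]} (hx : ‖x‖ < 1) :
    NormedSpace.exp (-x) = (NormedSpace.exp x)⁻¹ := by
  have h := exp_add hp hx (y := -x) (by rwa [norm_neg])
  rw [add_neg_cancel, NormedSpace.exp_zero] at h
  exact eq_inv_of_mul_eq_one_right h.symm

/-- The `p`-adic exponential maps the open unit ball onto the open unit ball around `1`. -/
theorem exists_exp_eq (hp : p ≠ 2) {z : ℚ_[p]} (hz : ‖z - 1‖ < 1) :
    ∃ a : ℚ_[p], ‖a‖ < 1 ∧ NormedSpace.exp a = z := by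
  have hp1 : (1 : ℝ) < p := by exact_mod_cast hpp.out.one_lt
  have hpi : (p : ℝ)⁻¹ < 1 := inv_lt_one_of_one_lt₀ hp1
  have hmem : ∀ x : ℚ_[p], x ∈ Metric.closedBall (0 : ℚ_[p]) (p : ℝ)⁻¹ ↔ ‖x‖ < 1 := fun x => by
    rw [mem_closedBall_zero_iff]
    exact ⟨fun h => h.trans_lt hpi, norm_le_inv_of_norm_lt_one⟩
  have hc : ContinuousOn (fun x : ℚ_[p] => ‖NormedSpace.exp x - z‖)
      (Metric.closedBall (0 : ℚ_[p]) (p : ℝ)⁻¹) := by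
    refine ((NormedSpace.continuousOn_exp (𝕂 := ℚ_[p]).mono fun x hx => ?_).sub
      continuousOn_const).norm
    exact mem_ball_radius_expSeries hp ((hmem x).1 hx)
  -- A point of the compact ball minimizing the distance of `exp a` to z; a Newton step from it
  -- would come closer by a factor 1/p unless the distance is 0.
  obtain ⟨a, ha, hmin⟩ := (isCompact_closedBall (0 : ℚ_[p]) (p : ℝ)⁻¹).exists_isMinOn
    ⟨0, by simp⟩ hc
  have ha' := (hmem a).1 ha
  refine ⟨a, ha', ?_⟩
  by_contra hne
  have he := norm_exp_sub_one hp ha'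
  have he1 : ‖NormedSpace.exp a‖ = 1 := norm_eq_one_of_norm_sub_one_lt (by rwa [he])
  have he0 := exp_ne_zero hp ha'
  set d := z / NormedSpace.exp a - 1 with hd
  have hz' : z = NormedSpace.exp a * (1 + d) := by rw [hd]; field_simp; ring
  have hd0 : d ≠ 0 := by
    intro h
    rw [h] at hz'
    exact hne (by rw [hz', add_zero, mul_one])
  have hdn : ‖NormedSpace.exp a - z‖ = ‖d‖ := by
    rw [hz', mul_add, mul_one, sub_add_cancel_left, norm_neg, norm_mul, he1, one_mul]
  have hd1 : ‖d‖ < 1 := by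
    rw [← hdn, ← sub_sub_sub_cancel_right _ z 1]
    exact norm_sub_lt_one (by rwa [he]) hz
  have hm := hmin ((hmem (a + d)).2 (norm_add_lt_one ha' hd1))
  simp only [Set.mem_ofPred_eq] at hm
  rw [hdn, exp_add hp ha' hd1, hz', ← mul_sub, norm_mul, he1, one_mul, ← sub_sub] at hm
  have := hm.trans (norm_exp_sub_one_sub_le hp hd1)
  have hdpos := norm_pos_iff.2 hd0
  nlinarith

end Exponential

end PadicPotts

namespace PadicPotts

/-! ### Parents, children and edges in the rooted tree -/

section TreeStructure

variable {V : Type*} {G : SimpleGraph V} {x₀ : V}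

/-- The neighbour is the last vertex but one of the geodesic from the root. A closer neighbour off
that geodesic would have a geodesic extending it through x, hence a longer one. -/
theorem existsUnique_adj_dist_eq (hG : G.IsTree) {x : V} (hx : x ≠ x₀) :
    ∃! y, G.Adj x y ∧ G.dist x₀ x = G.dist x₀ y + 1 := by
  obtain ⟨w, hw, hlen⟩ := hG.connected.exists_path_of_dist x₀ x
  have hnil : ¬ w.Nil := fun h => hx h.eq.symm
  have hadj : G.Adj x w.penultimate := (w.adj_penultimate hnil).symm
  refine ⟨w.penultimate, ⟨hadj, ?_⟩, fun y hy => ?_⟩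
  · have h1 : G.dist x₀ w.penultimate ≤ w.dropLast.length := SimpleGraph.dist_le _
    have h2 := w.length_dropLast_add_one hnil
    have h3 := hG.dist_eq_dist_add_one_of_adj x₀ hadj
    omega
  · obtain ⟨r, hr, hrlen⟩ := hG.connected.exists_path_of_dist x₀ y
    have hmem : y ∈ w.support := by
      by_contra hmem
      have hx' := hG.isAcyclic.mem_support_of_ne_mem_support_of_adj_of_isPath hr hw
        hy.1.symm hmem
      have h4 := congrArg SimpleGraph.Walk.length (hG.isAcyclic.path_concat hw hr hy.1 hx')
      rw [SimpleGraph.Walk.length_concat] at h4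
      omega
    exact hG.isAcyclic.eq_penultimate_of_adj_end hw hy.1 hmem

variable (G x₀) in
open Classical in
/-- The neighbour of `x` that is closer to the root (the root itself, if `x` is the root of a
tree). -/
noncomputable def parent (x : V) : V :=
  if h : ∃ y, G.Adj x y ∧ G.dist x₀ x = G.dist x₀ y + 1 then h.choose else x₀

theorem parent_spec (hG : G.IsTree) {x : V} (hx : x ≠ x₀) :
    G.Adj x (parent G x₀ x) ∧ G.dist x₀ x = G.dist x₀ (parent G x₀ x) + 1 := by
  have h := (existsUnique_adj_dist_eq hG hx).exists
  rw [parent, dif_pos h]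
  exact h.choose_spec

theorem eq_parent (hG : G.IsTree) {x y : V} (h : G.Adj x y)
    (hd : G.dist x₀ x = G.dist x₀ y + 1) : y = parent G x₀ x := by
  have hx : x ≠ x₀ := by
    rintro rfl
    simp at hd
  exact (existsUnique_adj_dist_eq hG hx).unique ⟨h, hd⟩ (parent_spec hG hx)

theorem ne_root_of_mem_sphere_succ {n : ℕ} {x : V} (hx : x ∈ sphere G x₀ (n + 1)) : x ≠ x₀ := by
  rintro rfl
  simp [sphere] at hx

theorem parent_mem_sphere (hG : G.IsTree) {n : ℕ} {x : V} (hx : x ∈ sphere G x₀ (n + 1)) :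
    parent G x₀ x ∈ sphere G x₀ n := by
  have h := (parent_spec hG (ne_root_of_mem_sphere_succ hx)).2
  simp only [sphere, Set.mem_ofPred_eq] at hx ⊢
  omega

theorem not_mem_ball_of_mem_sphere_succ {n : ℕ} {x : V} (hx : x ∈ sphere G x₀ (n + 1)) :
    x ∉ ball G x₀ n := by
  simp only [sphere, ball, Set.mem_ofPred_eq] at hx ⊢
  omega

theorem ball_subset_ball {m n : ℕ} (h : m ≤ n) : ball G x₀ m ⊆ ball G x₀ n :=
  fun _ hx => le_trans hx h

theorem ball_zero (hG : G.IsTree) : ball G x₀ 0 = {x₀} := by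
  ext x
  simp [ball, hG.connected.dist_eq_zero_iff, eq_comm]

theorem finite_ball (hG : G.IsTree) (hfin : ∀ x, (G.neighborSet x).Finite) (n : ℕ) :
    (ball G x₀ n).Finite := by
  induction n with
  | zero => simp [ball_zero hG]
  | succ n ih =>
    refine (ih.union (ih.biUnion fun y _ => hfin y)).subset fun x hx => ?_
    by_cases h : x ∈ ball G x₀ n
    · exact Or.inl h
    · have hs := mem_sphere_of_not_mem_ball G x₀ hx h
      refine Or.inr (Set.mem_biUnion (sphere_subset_ball G x₀ n (parent_mem_sphere hG hs)) ?_)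
      exact (parent_spec hG (ne_root_of_mem_sphere_succ hs)).1.symm

theorem children_eq (hG : G.IsTree) {n : ℕ} {y : V} (hy : y ∈ sphere G x₀ n) :
    {x | x ∈ sphere G x₀ (n + 1) ∧ parent G x₀ x = y} =
      {x | G.Adj y x ∧ G.dist x₀ x = G.dist x₀ y + 1} := by
  ext x
  simp only [sphere, Set.mem_ofPred_eq] at hy ⊢
  constructor
  · rintro ⟨h1, rfl⟩
    have h2 := parent_spec hG (ne_root_of_mem_sphere_succ h1)
    exact ⟨h2.1.symm, h2.2⟩
  · rintro ⟨h1, h2⟩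
    exact ⟨by omega, (eq_parent hG h1.symm h2).symm⟩

theorem ncard_children_root (hG : G.IsTree) (hdeg : ∀ x, (G.neighborSet x).ncard = 3) :
    {x | x ∈ sphere G x₀ 1 ∧ parent G x₀ x = x₀}.ncard = 3 := by
  rw [← hdeg x₀, ← zero_add 1, children_eq hG (by simp [sphere])]
  congr 1
  ext x
  simp only [SimpleGraph.mem_neighborSet, Set.mem_ofPred_eq, and_iff_left_iff_imp]
  intro h
  rw [SimpleGraph.dist_self, SimpleGraph.dist_eq_one_iff_adj.2 h]

/-- One of the three neighbours is the parent. This 2 is the exponent in the fixed point equation;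
the 3 at the root is the exponent in Z_1. -/
theorem ncard_children (hG : G.IsTree) (hdeg : ∀ x, (G.neighborSet x).ncard = 3) {n : ℕ}
    (hn : 1 ≤ n) {y : V} (hy : y ∈ sphere G x₀ n) :
    {x | x ∈ sphere G x₀ (n + 1) ∧ parent G x₀ x = y}.ncard = 2 := by
  have hy0 : y ≠ x₀ := by
    obtain ⟨k, rfl⟩ := Nat.exists_eq_add_of_le' hn
    exact ne_root_of_mem_sphere_succ hy
  have hpar := parent_spec hG hy0
  rw [children_eq hG hy]
  have h : {x | G.Adj y x ∧ G.dist x₀ x = G.dist x₀ y + 1} =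
      G.neighborSet y \ {parent G x₀ y} := by
    ext x
    simp only [SimpleGraph.mem_neighborSet, Set.mem_ofPred_eq, Set.mem_sdiff, Set.mem_singleton_iff]
    refine and_congr_right fun hadj => ⟨?_, fun hne => ?_⟩
    · rintro h rfl
      omega
    · exact (hG.dist_eq_dist_add_one_of_adj x₀ hadj).resolve_left
        fun h => hne (eq_parent hG hadj h)
  rw [h, Set.ncard_sdiff_singleton_of_mem ((G.mem_neighborSet _ _).2 hpar.1), hdeg]

theorem sphere_nonempty (hG : G.IsTree) (hdeg : ∀ x, (G.neighborSet x).ncard = 3) (n : ℕ) :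
    (sphere G x₀ n).Nonempty := by
  induction n with
  | zero => exact ⟨x₀, by simp [sphere]⟩
  | succ n ih =>
    obtain ⟨y, hy⟩ := ih
    have h : {x | x ∈ sphere G x₀ (n + 1) ∧ parent G x₀ x = y}.ncard ≠ 0 := by
      rcases Nat.eq_zero_or_pos n with rfl | hn
      · rw [sphere, Set.mem_ofPred_eq, hG.connected.dist_eq_zero_iff] at hy
        subst hy
        simp [ncard_children_root hG hdeg]
      · simp [ncard_children hG hdeg hn hy]
    obtain ⟨x, hx⟩ := Set.nonempty_of_ncard_ne_zero h
    exact ⟨x, hx.1⟩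

section Edges

variable {q n : ℕ}

theorem concat_of_mem (σ : ball G x₀ n → Fin q) (ω : sphere G x₀ (n + 1) → Fin q)
    (x : ball G x₀ n) (h : (x : V) ∈ ball G x₀ (n + 1)) : concat G x₀ σ ω ⟨x, h⟩ = σ x :=
  dif_pos x.2

theorem concat_of_mem_sphere (σ : ball G x₀ n → Fin q) (ω : sphere G x₀ (n + 1) → Fin q)
    (x : sphere G x₀ (n + 1)) (h : (x : V) ∈ ball G x₀ (n + 1)) :
    concat G x₀ σ ω ⟨x, h⟩ = ω x :=
  dif_neg (not_mem_ball_of_mem_sphere_succ x.2)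

/-- The edge from a vertex of `W_{n+1}` to its parent. -/
noncomputable def parentEdge (hG : G.IsTree) (y : sphere G x₀ (n + 1)) :
    (G.induce (ball G x₀ (n + 1))).edgeSet :=
  ⟨s(⟨y, sphere_subset_ball G x₀ _ y.2⟩, ⟨parent G x₀ y, ball_subset_ball (Nat.le_succ n)
    (sphere_subset_ball G x₀ n (parent_mem_sphere hG y.2))⟩),
    (parent_spec hG (ne_root_of_mem_sphere_succ y.2)).1⟩

variable (G x₀ n) in
/-- An edge inside `V_n`, as an edge inside `V_{n+1}`. -/
def edgeInclusion (e : (G.induce (ball G x₀ n)).edgeSet) :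
    (G.induce (ball G x₀ (n + 1))).edgeSet :=
  ⟨Sym2.map (Set.inclusion (ball_subset_ball (Nat.le_succ n))) e, by
    obtain ⟨e, he⟩ := e
    induction e using Sym2.ind with
    | _ a b => exact he⟩

/-- Adjacent vertices of a tree lie at distances from the root that differ by exactly one, so an
edge that is new in V_{n+1} joins a vertex of W_{n+1} to its parent. Hence the energy increment is a
sum over W_{n+1}. -/
theorem bijective_edges (hG : G.IsTree) :
    Function.Bijective (Sum.elim (edgeInclusion G x₀ n) (parentEdge (n := n) hG)) := by
  have hinj : Function.Injective
      (Set.inclusion (ball_subset_ball (G := G) (x₀ := x₀) (Nat.le_succ n))) :=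
    Set.inclusion_injective _
  have hne : ∀ (e : (G.induce (ball G x₀ n)).edgeSet) (y : sphere G x₀ (n + 1)),
      edgeInclusion G x₀ n e ≠ parentEdge hG y := by
    rintro ⟨e, he⟩ y h
    induction e using Sym2.ind with
    | _ a b =>
      have h := congrArg Subtype.val h
      simp only [edgeInclusion, parentEdge, Sym2.map_mk, Sym2.eq_iff] at h
      rcases h with ⟨h, -⟩ | ⟨-, h⟩
      · exact not_mem_ball_of_mem_sphere_succ y.2 (congrArg Subtype.val h ▸ a.2)
      · exact not_mem_ball_of_mem_sphere_succ y.2 (congrArg Subtype.val h ▸ b.2)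
  refine ⟨Function.Injective.sumElim ?_ ?_ hne, ?_⟩
  · intro e e' h
    exact Subtype.ext (Sym2.map.injective hinj (congrArg Subtype.val h))
  · intro y y' h
    have h := congrArg Subtype.val h
    simp only [parentEdge, Sym2.eq_iff, Subtype.mk.injEq] at h
    rcases h with ⟨h, -⟩ | ⟨h, -⟩
    · exact Subtype.ext h
    · have h1 := parent_mem_sphere hG y'.2
      have h2 := y.2
      rw [← h] at h1
      simp only [sphere, Set.mem_ofPred_eq] at h1 h2
      omega
  · have key : ∀ a b : ball G x₀ (n + 1), (h : G.Adj a b) → (a : V) ∉ ball G x₀ n →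
        ∃ y : sphere G x₀ (n + 1), (parentEdge hG y).1 = s(a, b) := by
      intro a b hab ha
      have hs := mem_sphere_of_not_mem_ball G x₀ a.2 ha
      have hb : (b : V) = parent G x₀ a := by
        refine eq_parent hG hab ((hG.dist_eq_dist_add_one_of_adj x₀ hab).resolve_right ?_)
        have h1 := b.2
        simp only [sphere, ball, Set.mem_ofPred_eq] at hs h1
        omega
      refine ⟨⟨a, hs⟩, ?_⟩
      simp only [parentEdge, Sym2.eq_iff]
      exact Or.inl ⟨trivial, Subtype.ext hb.symm⟩
    rintro ⟨e, he⟩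
    induction e using Sym2.ind with
    | _ a b =>
      have hab : G.Adj a b := he
      by_cases ha : (a : V) ∈ ball G x₀ n
      · by_cases hb : (b : V) ∈ ball G x₀ n
        · exact ⟨Sum.inl ⟨s(⟨a, ha⟩, ⟨b, hb⟩), hab⟩, rfl⟩
        · obtain ⟨y, hy⟩ := key b a hab.symm hb
          exact ⟨Sum.inr y, Subtype.ext (hy.trans Sym2.eq_swap)⟩
      · obtain ⟨y, hy⟩ := key a b hab ha
        exact ⟨Sum.inr y, Subtype.ext hy⟩

variable {p : ℕ} [Fact p.Prime]

open Classical in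
theorem hamiltonian_concat (hG : G.IsTree) (hfin : ∀ x, (G.neighborSet x).Finite) (J : ℚ_[p])
    [Fintype (sphere G x₀ (n + 1))] (σ : ball G x₀ n → Fin q)
    (ω : sphere G x₀ (n + 1) → Fin q) :
    hamiltonian G x₀ J (concat G x₀ σ ω) = hamiltonian G x₀ J σ +
      J * ∑ y : sphere G x₀ (n + 1),
        if ω y = σ ⟨parent G x₀ y, sphere_subset_ball G x₀ n (parent_mem_sphere hG y.2)⟩
          then 1 else 0 := by
  have := (finite_ball (x₀ := x₀) hG hfin n).to_subtype
  have := (finite_ball (x₀ := x₀) hG hfin (n + 1)).to_subtype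
  have := Fintype.ofFinite (G.induce (ball G x₀ n)).edgeSet
  have := Fintype.ofFinite (G.induce (ball G x₀ (n + 1))).edgeSet
  rw [hamiltonian, hamiltonian, finsum_eq_sum_of_fintype, finsum_eq_sum_of_fintype, ← mul_add,
    ← (bijective_edges (n := n) hG).sum_comp, Fintype.sum_sum_type]
  congr 2
  · refine Finset.sum_congr rfl fun e _ => ?_
    obtain ⟨e, he⟩ := e
    induction e using Sym2.ind with
    | _ a b =>
      simp only [Sum.elim_inl, edgeInclusion, Sym2.map_mk, Sym2.mk_isDiag_iff]
      congr 1
      simp only [Set.inclusion, concat_of_mem]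
  · refine Finset.sum_congr rfl fun y _ => ?_
    simp only [Sum.elim_inr, parentEdge, Sym2.map_mk, Sym2.mk_isDiag_iff]
    congr 1
    rw [concat_of_mem_sphere, concat_of_mem σ ω ⟨parent G x₀ y, _⟩]

variable (G x₀ n) in
/-- A configuration on `V_{n+1}` is a configuration on `V_n` together with one on `W_{n+1}`. -/
noncomputable def concatEquiv : (ball G x₀ n → Fin q) × (sphere G x₀ (n + 1) → Fin q) ≃
    (ball G x₀ (n + 1) → Fin q) where
  toFun s := concat G x₀ s.1 s.2
  invFun τ := (fun x => τ ⟨x, ball_subset_ball (Nat.le_succ n) x.2⟩,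
    fun x => τ ⟨x, sphere_subset_ball G x₀ _ x.2⟩)
  left_inv s := by
    ext x
    · simp only [concat_of_mem]
    · simp only [concat_of_mem_sphere]
  right_inv τ := by
    ext x
    by_cases h : (x : V) ∈ ball G x₀ n
    · simp only [concat, dif_pos h]
    · simp only [concat, dif_neg h]

end Edges

end TreeStructure

end PadicPotts

namespace PadicPotts

/-! ### Summing out the outer sphere -/

theorem prod_update_const {ι α M : Type*} [Fintype ι] [DecidableEq ι] [CommMonoid M]
    (f : α → M) (x₁ : ι) (i j : α) :
    ∏ x, f (if x = x₁ then i else j) = f i * f j ^ (Fintype.card ι - 1) := by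
  rw [← Finset.mul_prod_erase Finset.univ _ (Finset.mem_univ x₁), if_pos rfl]
  congr 1
  rw [Finset.prod_congr rfl fun x hx => by rw [if_neg (Finset.ne_of_mem_erase hx)],
    Finset.prod_const, Finset.card_erase_of_mem (Finset.mem_univ _), Finset.card_univ]

/-- If the products of the values of `f` and `g` along all words are proportional, so are
`f` and `g`. -/
theorem mul_eq_mul_of_prod_proportional {ι α K : Type*} [Fintype ι] [Nonempty ι] [Field K]
    {f g : α → K} {k k' : K} (hk : k ≠ 0) (hk' : k' ≠ 0) (hg : ∀ i, g i ≠ 0)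
    (h : ∀ σ : ι → α, k * ∏ x, f (σ x) = k' * ∏ x, g (σ x)) (i j : α) :
    f i * g j = f j * g i := by
  classical
  obtain ⟨x₁⟩ := ‹Nonempty ι›
  obtain ⟨N, hN⟩ : ∃ N, Fintype.card ι = N + 1 :=
    Nat.exists_eq_add_of_le' (Fintype.card_pos_iff.2 ⟨x₁⟩)
  -- Compare the constant word j with the word differing from it at one place, where it is i.
  have h1 := h fun x => if x = x₁ then i else j
  have h2 := h fun _ => j
  rw [prod_update_const, prod_update_const, hN, Nat.add_sub_cancel] at h1
  rw [Finset.prod_const, Finset.prod_const, Finset.card_univ, hN] at h2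
  have hf : f j ≠ 0 := by
    intro h0
    rw [h0, zero_pow N.succ_ne_zero, mul_zero] at h2
    exact mul_ne_zero hk' (pow_ne_zero _ (hg j)) h2.symm
  refine mul_left_cancel₀ (mul_ne_zero hk (pow_ne_zero N hf)) ?_
  linear_combination g j * h1 - g i * h2

section Weights

variable {p : ℕ} [hpp : Fact p.Prime] {V : Type*} {G : SimpleGraph V} {x₀ : V} {q n : ℕ}

/-- The contribution of a vertex of `W_{n+1}`, summed over its spin, as a function of the spin of
its parent; `ζ` is the exponential of the boundary field, `θ` that of the coupling constant. -/
noncomputable def branch (θ : ℚ_[p]) (ζ : Fin q → ℚ_[p]) (j : Fin q) : ℚ_[p] := (θ - 1) * ζ j + ∑ i, ζ i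

theorem sum_ite_mul_eq_branch (θ : ℚ_[p]) (ζ : Fin q → ℚ_[p]) (j : Fin q) :
    ∑ i, (if i = j then θ else 1) * ζ i = branch θ ζ j := by
  have h : ∀ i, (if i = j then θ else 1) * ζ i = (if i = j then (θ - 1) * ζ i else 0) + ζ i := by
    intro i
    split_ifs <;> ring
  rw [Finset.sum_congr rfl fun i _ => h i, Finset.sum_add_distrib, Finset.sum_ite_eq',
    if_pos (Finset.mem_univ j), branch]

variable (G x₀ n) in
/-- The parent, as a map from `W_{n+1}` to `W_n`. -/
noncomputable def parentSphere (hG : G.IsTree) (y : sphere G x₀ (n + 1)) : sphere G x₀ n :=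
  ⟨parent G x₀ y, parent_mem_sphere hG y.2⟩

theorem card_parentSphere_fiber (hG : G.IsTree) (x : sphere G x₀ n) :
    Nat.card {y // parentSphere G x₀ n hG y = x} =
      {y | y ∈ sphere G x₀ (n + 1) ∧ parent G x₀ y = x}.ncard := by
  refine Nat.card_congr ⟨fun y => ⟨y.1, y.1.2, congrArg Subtype.val y.2⟩,
    fun y => ⟨⟨y, y.2.1⟩, Subtype.ext y.2.2⟩, fun y => rfl, fun y => rfl⟩

theorem prod_parentSphere [Fintype (sphere G x₀ n)] [Fintype (sphere G x₀ (n + 1))]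
    (hG : G.IsTree) {k : ℕ} (f : sphere G x₀ n → ℚ_[p])
    (hk : ∀ x ∈ sphere G x₀ n, {y | y ∈ sphere G x₀ (n + 1) ∧ parent G x₀ y = x}.ncard = k) :
    ∏ y, f (parentSphere G x₀ n hG y) = ∏ x, f x ^ k := by
  classical
  rw [← Fintype.prod_fiberwise' (parentSphere G x₀ n hG) f]
  refine Finset.prod_congr rfl fun x _ => ?_
  rw [Finset.prod_const, Finset.card_univ, ← Nat.card_eq_fintype_card, card_parentSphere_fiber hG,
    hk x x.2]

theorem norm_hamiltonian_lt_one {J : ℚ_[p]} (hJ : ‖J‖ < 1) (σ : ball G x₀ n → Fin q)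
    [Finite (ball G x₀ n)] : ‖hamiltonian G x₀ J σ‖ < 1 := by
  have := Fintype.ofFinite (G.induce (ball G x₀ n)).edgeSet
  rw [hamiltonian, finsum_eq_sum_of_fintype, Finset.mul_sum]
  refine norm_sum_lt_one _ _ fun e _ => ?_
  split_ifs
  · rwa [mul_one]
  · simp

/-- Isolates the vertex constants c in a factor independent of σ, which cancels on normalization. -/
theorem weight_eq_exp_mul_prod (hp : p ≠ 2) [Finite (ball G x₀ n)] [Fintype (sphere G x₀ n)]
    {J : ℚ_[p]} (hJ : ‖J‖ < 1) {h : V → Fin q → ℚ_[p]} {c : V → ℚ_[p]} {η : Fin q → ℚ_[p]}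
    (hc : ∀ x, ‖c x‖ < 1) (hη : ∀ i, ‖η i‖ < 1) (hh : ∀ x i, h x i = c x + η i)
    (σ : ball G x₀ n → Fin q) :
    weight G x₀ J h σ = NormedSpace.exp (hamiltonian G x₀ J σ) *
      (∏ x : sphere G x₀ n, NormedSpace.exp (c x)) *
        ∏ x : sphere G x₀ n, NormedSpace.exp (η (σ ⟨x, sphere_subset_ball G x₀ n x.2⟩)) := by
  have hn : ∀ x i, ‖h x i‖ < 1 := fun x i => hh x i ▸ norm_add_lt_one (hc x) (hη i)
  rw [weight, finsum_eq_sum_of_fintype, exp_add hp (norm_hamiltonian_lt_one hJ σ)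
    (norm_sum_lt_one _ _ fun x _ => hn _ _), exp_sum hp _ _ fun x _ => hn _ _, mul_assoc,
    ← Finset.prod_mul_distrib]
  congr 1
  refine Finset.prod_congr rfl fun x _ => ?_
  rw [hh, exp_add hp (hc _) (hη _)]

theorem exp_mul_ite (J : ℚ_[p]) (P : Prop) [Decidable P] :
    NormedSpace.exp (J * if P then 1 else 0) = if P then NormedSpace.exp J else 1 := by
  split_ifs
  · rw [mul_one]
  · rw [mul_zero, NormedSpace.exp_zero]

open Classical in
theorem exp_hamiltonian_concat (hp : p ≠ 2) (hG : G.IsTree)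
    (hfin : ∀ x, (G.neighborSet x).Finite) [Fintype (sphere G x₀ (n + 1))]
    {J : ℚ_[p]} (hJ : ‖J‖ < 1) (σ : ball G x₀ n → Fin q) (ω : sphere G x₀ (n + 1) → Fin q) :
    NormedSpace.exp (hamiltonian G x₀ J (concat G x₀ σ ω)) =
      NormedSpace.exp (hamiltonian G x₀ J σ) * ∏ y : sphere G x₀ (n + 1),
        if ω y = σ ⟨_, sphere_subset_ball G x₀ n (parentSphere G x₀ n hG y).2⟩
          then NormedSpace.exp J else 1 := by
  have := (finite_ball (x₀ := x₀) hG hfin n).to_subtype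
  have hb : ∀ (P : Prop) [Decidable P], ‖J * (if P then 1 else 0)‖ < 1 := by
    intro P _
    split_ifs
    · rwa [mul_one]
    · simp
  rw [hamiltonian_concat hG hfin, Finset.mul_sum]
  refine (exp_add hp (norm_hamiltonian_lt_one hJ σ)
    (norm_sum_lt_one _ _ fun y _ => hb _)).trans ?_
  congr 1
  refine (exp_sum hp _ _ fun y _ => hb _).trans (Finset.prod_congr rfl fun y _ => exp_mul_ite J _)

open Classical in
-- Each new vertex interacts with its parent only, so the sum over ω of a product over W_{n+1} is a
-- product of one-vertex sums.
theorem sum_weight_concat_eq_prod (hp : p ≠ 2) (hG : G.IsTree)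
    (hfin : ∀ x, (G.neighborSet x).Finite) [Fintype (sphere G x₀ (n + 1))]
    {J : ℚ_[p]} (hJ : ‖J‖ < 1) {h : V → Fin q → ℚ_[p]} {c : V → ℚ_[p]} {η : Fin q → ℚ_[p]}
    (hc : ∀ x, ‖c x‖ < 1) (hη : ∀ i, ‖η i‖ < 1) (hh : ∀ x i, h x i = c x + η i)
    (σ : ball G x₀ n → Fin q) :
    ∑ ω : sphere G x₀ (n + 1) → Fin q, weight G x₀ J h (concat G x₀ σ ω) =
      NormedSpace.exp (hamiltonian G x₀ J σ) *
        (∏ y : sphere G x₀ (n + 1), NormedSpace.exp (c y)) *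
          ∏ y : sphere G x₀ (n + 1), branch (NormedSpace.exp J) (fun i => NormedSpace.exp (η i))
            (σ ⟨_, sphere_subset_ball G x₀ n (parentSphere G x₀ n hG y).2⟩) := by
  have := (finite_ball (x₀ := x₀) hG hfin n).to_subtype
  have := (finite_ball (x₀ := x₀) hG hfin (n + 1)).to_subtype
  simp only [← sum_ite_mul_eq_branch]
  rw [Fintype.prod_sum, Finset.mul_sum]
  refine Finset.sum_congr rfl fun ω _ => ?_
  rw [weight_eq_exp_mul_prod hp hJ hc hη hh, exp_hamiltonian_concat hp hG hfin hJ,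
    Finset.prod_mul_distrib]
  simp only [concat_of_mem_sphere]
  ring

theorem partitionFunction_succ [Finite (ball G x₀ n)] [Finite (ball G x₀ (n + 1))]
    [Finite (sphere G x₀ (n + 1))] (J : ℚ_[p]) (h : V → Fin q → ℚ_[p]) :
    partitionFunction G x₀ J h (n + 1) = ∑ᶠ σ : ball G x₀ n → Fin q,
      ∑ᶠ ω : sphere G x₀ (n + 1) → Fin q, weight G x₀ J h (concat G x₀ σ ω) := by
  classical
  have := Fintype.ofFinite (ball G x₀ n)
  have := Fintype.ofFinite (ball G x₀ (n + 1))
  have := Fintype.ofFinite (sphere G x₀ (n + 1))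
  simp only [partitionFunction, finsum_eq_sum_of_fintype]
  rw [← (concatEquiv G x₀ n).sum_comp, Fintype.sum_prod_type]
  rfl

theorem finite_sphere (hG : G.IsTree) (hfin : ∀ x, (G.neighborSet x).Finite) (n : ℕ) :
    (sphere G x₀ n).Finite :=
  (finite_ball hG hfin n).subset (sphere_subset_ball G x₀ n)

theorem finite_neighborSet (hdeg : ∀ x, (G.neighborSet x).ncard = 3) (x : V) :
    (G.neighborSet x).Finite :=
  Set.finite_of_ncard_ne_zero (by rw [hdeg]; norm_num)

theorem eq_root_of_mem_ball_zero (hG : G.IsTree) {x : V} (hx : x ∈ ball G x₀ 0) : x = x₀ := by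
  rwa [ball_zero hG] at hx

theorem hamiltonian_ball_zero (hG : G.IsTree) (J : ℚ_[p]) (σ : ball G x₀ 0 → Fin q) :
    hamiltonian G x₀ J σ = 0 := by
  rw [hamiltonian, finsum_eq_zero_of_forall_eq_zero, mul_zero]
  rintro ⟨e, he⟩
  exfalso
  induction e using Sym2.ind with
  | _ a b =>
    exact G.ne_of_adj he ((eq_root_of_mem_ball_zero hG a.2).trans
      (eq_root_of_mem_ball_zero hG b.2).symm)

/-- The first partition function, up to a nonzero factor. -/
theorem partitionFunction_one (hp : p ≠ 2) (hG : G.IsTree)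
    (hdeg : ∀ x, (G.neighborSet x).ncard = 3) [Fintype (sphere G x₀ 1)]
    {J : ℚ_[p]} (hJ : ‖J‖ < 1) {h : V → Fin q → ℚ_[p]} {c : V → ℚ_[p]} {η : Fin q → ℚ_[p]}
    (hc : ∀ x, ‖c x‖ < 1) (hη : ∀ i, ‖η i‖ < 1) (hh : ∀ x i, h x i = c x + η i) :
    partitionFunction G x₀ J h 1 = (∏ y : sphere G x₀ 1, NormedSpace.exp (c y)) *
      ∑ j, branch (NormedSpace.exp J) (fun i => NormedSpace.exp (η i)) j ^ 3 := by
  classical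
  have hfin := finite_neighborSet hdeg
  have := (finite_ball (x₀ := x₀) hG hfin 0).to_subtype
  have := (finite_ball (x₀ := x₀) hG hfin 1).to_subtype
  have := Fintype.ofFinite (ball G x₀ 0)
  let : Unique (sphere G x₀ 0) :=
    { default := ⟨x₀, by simp [sphere]⟩
      uniq := fun x => Subtype.ext
        (eq_root_of_mem_ball_zero hG (sphere_subset_ball G x₀ 0 x.2)) }
  let : Unique (ball G x₀ 0) :=
    { default := ⟨x₀, by simp [ball]⟩
      uniq := fun x => Subtype.ext (eq_root_of_mem_ball_zero hG x.2) }
  -- V_0 is the root alone: a configuration on it is one spin j, and each of the three children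
  -- contributes `branch` at j.
  rw [partitionFunction_succ]
  simp only [finsum_eq_sum_of_fintype]
  rw [Finset.mul_sum, ← (Equiv.funUnique (ball G x₀ 0) (Fin q)).sum_comp]
  refine Finset.sum_congr rfl fun σ _ => ?_
  rw [sum_weight_concat_eq_prod hp hG hfin hJ hc hη hh, hamiltonian_ball_zero hG,
    NormedSpace.exp_zero, one_mul]
  congr 1
  rw [prod_parentSphere hG (fun x => branch (NormedSpace.exp J) (fun i => NormedSpace.exp (η i))
    (σ ⟨_, sphere_subset_ball G x₀ 0 x.2⟩)) (k := 3) ?_]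
  · rw [Fintype.prod_unique]
    rfl
  · intro x hx
    rw [eq_root_of_mem_ball_zero hG (sphere_subset_ball G x₀ 0 hx)]
    exact ncard_children_root hG hdeg

theorem sum_weight_concat (hp : p ≠ 2) (hG : G.IsTree)
    (hdeg : ∀ x, (G.neighborSet x).ncard = 3) (hn : 1 ≤ n)
    [Fintype (sphere G x₀ n)] [Fintype (sphere G x₀ (n + 1))]
    {J : ℚ_[p]} (hJ : ‖J‖ < 1) {h : V → Fin q → ℚ_[p]} {c : V → ℚ_[p]} {η : Fin q → ℚ_[p]}
    (hc : ∀ x, ‖c x‖ < 1) (hη : ∀ i, ‖η i‖ < 1) (hh : ∀ x i, h x i = c x + η i)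
    (σ : ball G x₀ n → Fin q) :
    ∑ᶠ ω : sphere G x₀ (n + 1) → Fin q, weight G x₀ J h (concat G x₀ σ ω) =
      NormedSpace.exp (hamiltonian G x₀ J σ) *
        (∏ y : sphere G x₀ (n + 1), NormedSpace.exp (c y)) *
          ∏ x : sphere G x₀ n, branch (NormedSpace.exp J) (fun i => NormedSpace.exp (η i))
            (σ ⟨x, sphere_subset_ball G x₀ n x.2⟩) ^ 2 := by
  classical
  have hfin := finite_neighborSet hdeg
  rw [finsum_eq_sum_of_fintype, sum_weight_concat_eq_prod hp hG hfin hJ hc hη hh]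
  congr 1
  exact prod_parentSphere hG (fun x => branch (NormedSpace.exp J) (fun i => NormedSpace.exp (η i))
    (σ ⟨x, sphere_subset_ball G x₀ n x.2⟩)) (k := 2) fun x hx => ncard_children hG hdeg hn hx

end Weights

end PadicPotts

namespace PadicPotts

/-! ### Extending consistent distributions to the cylinder algebra -/

section Extension

variable {p : ℕ} [hpp : Fact p.Prime] {V : Type*} {G : SimpleGraph V} {x₀ : V} {q : ℕ}

/-- Membership in `A` depends on the spins in `V_n` only. -/
def IsDetermined (G : SimpleGraph V) (x₀ : V) (n : ℕ) (A : Set (V → Fin q)) : Prop :=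
  ∀ τ τ' : V → Fin q, (∀ x ∈ ball G x₀ n, τ x = τ' x) → (τ ∈ A ↔ τ' ∈ A)

theorem IsDetermined.mono {m n : ℕ} (h : m ≤ n) {A : Set (V → Fin q)}
    (hA : IsDetermined G x₀ m A) : IsDetermined G x₀ n A :=
  fun τ τ' hτ => hA τ τ' fun x hx => hτ x (ball_subset_ball h hx)

theorem exists_isDetermined (G : SimpleGraph V) (x₀ : V) {A : Set (V → Fin q)}
    (hA : A ∈ cylinders V q) : ∃ n, 1 ≤ n ∧ IsDetermined G x₀ n A := by
  obtain ⟨s, S, rfl⟩ := hA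
  -- The extra 1 ensures n ≥ 1, the range in which the distributions are defined and consistent.
  refine ⟨s.sup (G.dist x₀) + 1, by omega, fun τ τ' h => ?_⟩
  simp only [Set.mem_ofPred_eq]
  have : (fun x : s => τ x) = fun x : s => τ' x := by
    funext x
    exact h x ((Finset.le_sup (f := G.dist x₀) x.2).trans (Nat.le_succ _))
  rw [this]

theorem mem_cylinders_of_isDetermined {n : ℕ} (hfin : (ball G x₀ n).Finite)
    {A : Set (V → Fin q)} (hA : IsDetermined G x₀ n A) : A ∈ cylinders V q := by
  refine ⟨hfin.toFinset, {ρ | ∃ τ ∈ A, ∀ x : hfin.toFinset, τ x = ρ x}, ?_⟩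
  ext τ
  simp only [Set.mem_ofPred_eq]
  refine ⟨fun h => ⟨τ, h, fun _ => rfl⟩, ?_⟩
  rintro ⟨τ', hτ', h⟩
  exact (hA τ' τ fun x hx => h ⟨x, hfin.mem_toFinset.2 hx⟩).1 hτ'

theorem isDetermined_cylinderOf {n : ℕ} (σ : ball G x₀ n → Fin q) :
    IsDetermined G x₀ n (cylinderOf G x₀ σ) := by
  intro τ τ' h
  exact forall_congr' fun x => by rw [h x x.2]

theorem disjoint_cylinderOf {n : ℕ} {σ σ' : ball G x₀ n → Fin q} (h : σ ≠ σ') :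
    Disjoint (cylinderOf G x₀ σ) (cylinderOf G x₀ σ') := by
  rw [Set.disjoint_left]
  intro τ h1 h2
  exact h (funext fun x => (h1 x).symm.trans (h2 x))

/-- A measure on the cylinder sets is determined by its values on the sets `{τ | τ|_{V_n} = σ}`. -/
theorem PadicMeasure.ext_of_cylinderOf (hfin : ∀ n, (ball G x₀ n).Finite)
    {μ μ' : PadicMeasure p (cylinders V q)}
    (h : ∀ n, 1 ≤ n → ∀ (σ : ball G x₀ n → Fin q) (A : cylinders V q),
      (A : Set (V → Fin q)) = cylinderOf G x₀ σ → μ.toFun A = μ'.toFun A) : μ = μ' := by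
  refine PadicMeasure.ext (funext fun A => ?_)
  obtain ⟨n, hn, hA⟩ := exists_isDetermined G x₀ A.2
  have := (hfin n).to_subtype
  -- A set determined on V_n is the finite disjoint union of the cylinders of its restrictions to
  -- V_n, so additivity forces its value.
  let T := {σ : ball G x₀ n → Fin q // ∃ τ ∈ (A : Set (V → Fin q)), τ ∈ cylinderOf G x₀ σ}
  have : Fintype T := Fintype.ofFinite T
  let e := (Fintype.equivFin T).symm
  let C : Fin (Fintype.card T) → cylinders V q := fun i => ⟨cylinderOf G x₀ (e i).1,
    mem_cylinders_of_isDetermined (hfin n) (isDetermined_cylinderOf _)⟩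
  have hdisj : ∀ i j, i ≠ j → Disjoint (C i : Set (V → Fin q)) (C j : Set (V → Fin q)) :=
    fun i j hij => disjoint_cylinderOf fun h => hij (e.injective (Subtype.ext h))
  have hU : (A : Set (V → Fin q)) = ⋃ j, (C j : Set (V → Fin q)) := by
    ext τ
    rw [Set.mem_iUnion]
    constructor
    · intro hτ
      refine ⟨e.symm ⟨fun x => τ x, τ, hτ, fun _ => rfl⟩, fun x => ?_⟩
      simp
    · rintro ⟨i, hi⟩
      obtain ⟨τ', h1, h2⟩ := (e i).2
      exact (hA τ' τ fun x hx => (h2 ⟨x, hx⟩).trans (hi ⟨x, hx⟩).symm).1 h1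
  rw [μ.additive _ C A hdisj hU, μ'.additive _ C A hdisj hU]
  exact Finset.sum_congr rfl fun i _ => h n hn (e i).1 (C i) rfl

open Classical in
/-- The extension of a configuration on `V_n` by the constant `d`. -/
noncomputable def extendBy (d : Fin q) {n : ℕ} (σ : ball G x₀ n → Fin q) : V → Fin q :=
  fun x => if h : x ∈ ball G x₀ n then σ ⟨x, h⟩ else d

theorem extendBy_of_mem (d : Fin q) {n : ℕ} (σ : ball G x₀ n → Fin q) {x : V}
    (hx : x ∈ ball G x₀ n) : extendBy d σ x = σ ⟨x, hx⟩ :=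
  dif_pos hx

open Classical in
/-- The sum of the weights of those configurations on `V_n` whose extension lies in `A`. -/
noncomputable def cylinderSum (d : Fin q) (n : ℕ) (f : (ball G x₀ n → Fin q) → ℚ_[p])
    (A : Set (V → Fin q)) : ℚ_[p] :=
  ∑ᶠ σ, if extendBy d σ ∈ A then f σ else 0

/-- Membership in A does not depend on ω, so the inner sum collapses by consistency. For the same
reason the filler spin d is immaterial. -/
theorem cylinderSum_succ (hfin : ∀ n, (ball G x₀ n).Finite) (d : Fin q) {n : ℕ}
    {f : (ball G x₀ n → Fin q) → ℚ_[p]} {g : (ball G x₀ (n + 1) → Fin q) → ℚ_[p]}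
    (hfg : ∀ σ, ∑ᶠ ω, g (concat G x₀ σ ω) = f σ)
    {A : Set (V → Fin q)} (hA : IsDetermined G x₀ n A) :
    cylinderSum d (n + 1) g A = cylinderSum d n f A := by
  classical
  have := (hfin n).fintype
  have := (hfin (n + 1)).fintype
  have := ((hfin (n + 1)).subset (sphere_subset_ball G x₀ (n + 1))).fintype
  rw [cylinderSum, cylinderSum, finsum_eq_sum_of_fintype, finsum_eq_sum_of_fintype,
    ← (concatEquiv G x₀ n).sum_comp, Fintype.sum_prod_type]
  refine Finset.sum_congr rfl fun σ _ => ?_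
  rw [← hfg, finsum_eq_sum_of_fintype]
  have key : ∀ ω : sphere G x₀ (n + 1) → Fin q,
      extendBy d (concat G x₀ σ ω) ∈ A ↔ extendBy d σ ∈ A := fun ω => hA _ _ fun x hx => by
    rw [extendBy_of_mem d _ (ball_subset_ball (Nat.le_succ n) hx), extendBy_of_mem d σ hx]
    exact concat_of_mem σ ω ⟨x, hx⟩ _
  change ∑ ω, (if extendBy d (concat G x₀ σ ω) ∈ A then g (concat G x₀ σ ω) else 0) = _
  simp only [key]
  split_ifs
  · rfl
  · exact Finset.sum_const_zero

theorem cylinderSum_eq_of_le (hfin : ∀ n, (ball G x₀ n).Finite) (d : Fin q)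
    {f : ∀ n, (ball G x₀ n → Fin q) → ℚ_[p]}
    (hf : ∀ n, 1 ≤ n → ∀ σ, ∑ᶠ ω, f (n + 1) (concat G x₀ σ ω) = f n σ)
    {A : Set (V → Fin q)} {m n : ℕ} (hm : 1 ≤ m) (hmn : m ≤ n) (hA : IsDetermined G x₀ m A) :
    cylinderSum d n (f n) A = cylinderSum d m (f m) A := by
  induction n, hmn using Nat.le_induction with
  | base => rfl
  | succ n hmn ih => rw [← ih, cylinderSum_succ hfin d (hf n (hm.trans hmn)) (hA.mono hmn)]

/-- A consistent family of finite-dimensional distributions extends to a measure on the cylinder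
sets. -/
theorem exists_padicMeasure (hfin : ∀ n, (ball G x₀ n).Finite) (d : Fin q)
    {f : ∀ n, (ball G x₀ n → Fin q) → ℚ_[p]}
    (hf : ∀ n, 1 ≤ n → ∀ σ, ∑ᶠ ω, f (n + 1) (concat G x₀ σ ω) = f n σ)
    (hprob : ∑ᶠ σ, f 1 σ = 1) :
    ∃ μ : PadicMeasure p (cylinders V q),
      (∀ A : cylinders V q, (A : Set (V → Fin q)) = Set.univ → μ.toFun A = 1) ∧
      ∀ n, 1 ≤ n → ∀ (σ : ball G x₀ n → Fin q) (A : cylinders V q),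
        (A : Set (V → Fin q)) = cylinderOf G x₀ σ → μ.toFun A = f n σ := by
  classical
  choose N hN hdet using fun A : cylinders V q => exists_isDetermined G x₀ A.2
  -- The value at A does not depend on the level used: compare two levels with their maximum.
  have key : ∀ (A : cylinders V q) (n : ℕ), 1 ≤ n → IsDetermined G x₀ n (A : Set (V → Fin q)) →
      cylinderSum d (N A) (f (N A)) A = cylinderSum d n (f n) A := by
    intro A n hn hA
    rw [← cylinderSum_eq_of_le hfin d hf (hN A) (le_max_left (N A) n) (hdet A),
      ← cylinderSum_eq_of_le hfin d hf hn (le_max_right (N A) n) hA]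
  refine ⟨⟨fun A => cylinderSum d (N A) (f (N A)) A, ?_⟩, ?_, ?_⟩
  · intro k A U hdisj hU
    obtain ⟨n, hnU, hnA⟩ : ∃ n, N U ≤ n ∧ ∀ j, N (A j) ≤ n :=
      ⟨max (N U) (Finset.univ.sup fun j => N (A j)), le_max_left _ _, fun j =>
        (Finset.le_sup (f := fun j => N (A j)) (Finset.mem_univ j)).trans (le_max_right _ _)⟩
    have hn := (hN U).trans hnU
    have := (hfin n).fintype
    rw [key U n hn ((hdet U).mono hnU),
      Finset.sum_congr rfl fun j _ => key (A j) n hn ((hdet (A j)).mono (hnA j))]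
    simp only [cylinderSum, finsum_eq_sum_of_fintype]
    rw [Finset.sum_comm]
    refine Finset.sum_congr rfl fun σ _ => ?_
    by_cases h : extendBy d σ ∈ (U : Set (V → Fin q))
    · rw [if_pos h]
      rw [hU, Set.mem_iUnion] at h
      obtain ⟨j, hj⟩ := h
      rw [Finset.sum_eq_single_of_mem j (Finset.mem_univ j), if_pos hj]
      intro i _ hij
      exact if_neg fun hi => Set.disjoint_left.1 (hdisj i j hij) hi hj
    · rw [if_neg h]
      rw [hU, Set.mem_iUnion, not_exists] at h
      exact (Finset.sum_eq_zero fun j _ => if_neg (h j)).symm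
  · intro A hA
    simp only
    rw [key A 1 le_rfl (by rw [hA]; exact fun _ _ _ => Iff.rfl), cylinderSum, ← hprob, hA]
    simp
  · intro n hn σ A hA
    have := (hfin n).fintype
    simp only
    rw [key A n hn (by rw [hA]; exact isDetermined_cylinderOf σ), cylinderSum,
      finsum_eq_sum_of_fintype, hA]
    have hiff : ∀ σ' : ball G x₀ n → Fin q, extendBy d σ' ∈ cylinderOf G x₀ σ ↔ σ' = σ := by
      intro σ'
      refine ⟨fun h => funext fun x => ?_, ?_⟩
      · rw [← h x, extendBy_of_mem d σ' x.2]
      · rintro rfl x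
        exact extendBy_of_mem d σ' x.2
    simp only [hiff]
    rw [Finset.sum_ite_eq', if_pos (Finset.mem_univ σ)]

end Extension

/-! ### Compatibility as a fixed point equation -/

section Gibbs

variable {p : ℕ} [hpp : Fact p.Prime] {V : Type*} {G : SimpleGraph V} {x₀ : V} {q : ℕ}
  {J : ℚ_[p]} {h : V → Fin q → ℚ_[p]} {c : V → ℚ_[p]} {η : Fin q → ℚ_[p]}

/-- Level 1 already suffices: the spins on W_1 are arbitrary, so proportionality of the products
over W_1 passes to the factors. -/
theorem branch_sq_proportional (hp : p ≠ 2) (hG : G.IsTree)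
    (hdeg : ∀ x, (G.neighborSet x).ncard = 3) (hJ : ‖J‖ < 1)
    (hc : ∀ x, ‖c x‖ < 1) (hη : ∀ i, ‖η i‖ < 1) (hh : ∀ x i, h x i = c x + η i)
    (hZ : ∀ n, 1 ≤ n → partitionFunction G x₀ J h n ≠ 0)
    (hcomp : ∀ n, 1 ≤ n → ∀ σ : ball G x₀ n → Fin q,
      ∑ᶠ ω : sphere G x₀ (n + 1) → Fin q, finiteDistribution G x₀ J h (concat G x₀ σ ω) =
        finiteDistribution G x₀ J h σ) (i j : Fin q) :
    branch (NormedSpace.exp J) (fun i => NormedSpace.exp (η i)) i ^ 2 * NormedSpace.exp (η j) =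
      branch (NormedSpace.exp J) (fun i => NormedSpace.exp (η i)) j ^ 2 *
        NormedSpace.exp (η i) := by
  classical
  have hfin := finite_neighborSet hdeg
  have := (finite_ball (x₀ := x₀) hG hfin 1).to_subtype
  have := (finite_sphere (x₀ := x₀) hG hfin 1).fintype
  have := (finite_sphere (x₀ := x₀) hG hfin (1 + 1)).fintype
  have : Nonempty (sphere G x₀ 1) := (sphere_nonempty hG hdeg 1).to_subtype
  have hprod : ∀ n [Fintype (sphere G x₀ n)],
      (∏ x : sphere G x₀ n, NormedSpace.exp (c x)) ≠ 0 :=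
    fun n _ => Finset.prod_ne_zero_iff.2 fun x _ => exp_ne_zero hp (hc x)
  refine mul_eq_mul_of_prod_proportional (ι := sphere G x₀ 1)
    (f := fun i => branch (NormedSpace.exp J) (fun i => NormedSpace.exp (η i)) i ^ 2)
    (mul_ne_zero (inv_ne_zero (hZ (1 + 1) (by norm_num))) (hprod (1 + 1)))
    (mul_ne_zero (inv_ne_zero (hZ 1 le_rfl)) (hprod 1))
    (fun i => exp_ne_zero hp (hη i)) (fun ρ => ?_) i j
  -- The spin at the root is arbitrary, since exp(H(σ)) appears on both sides and cancels.
  let σ : ball G x₀ 1 → Fin q := fun x => if hx : (x : V) ∈ sphere G x₀ 1 then ρ ⟨x, hx⟩ else i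
  have hσ : ∀ x : sphere G x₀ 1, σ ⟨x, sphere_subset_ball G x₀ 1 x.2⟩ = ρ x :=
    fun x => dif_pos x.2
  have h1 := hcomp 1 le_rfl σ
  simp only [finiteDistribution] at h1
  rw [← mul_finsum, sum_weight_concat hp hG hdeg le_rfl hJ hc hη hh,
    weight_eq_exp_mul_prod hp hJ hc hη hh] at h1
  simp only [hσ] at h1
  refine mul_left_cancel₀ (exp_ne_zero hp (norm_hamiltonian_lt_one hJ σ)) ?_
  linear_combination h1

theorem sum_branch_cube_ne_zero (hp : p ≠ 2) (hG : G.IsTree)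
    (hdeg : ∀ x, (G.neighborSet x).ncard = 3) (hJ : ‖J‖ < 1)
    (hc : ∀ x, ‖c x‖ < 1) (hη : ∀ i, ‖η i‖ < 1) (hh : ∀ x i, h x i = c x + η i)
    (hZ : partitionFunction G x₀ J h 1 ≠ 0) :
    ∑ j, branch (NormedSpace.exp J) (fun i => NormedSpace.exp (η i)) j ^ 3 ≠ 0 := by
  have := (finite_sphere (x₀ := x₀) hG (finite_neighborSet hdeg) 1).fintype
  rw [partitionFunction_one hp hG hdeg hJ hc hη hh] at hZ
  exact right_ne_zero_of_mul hZ

/-- The converse direction: the factor D is independent of σ, hence also Z_{n+1} = D Z_n. This gives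
both nonvanishing and compatibility at all levels. -/
theorem exists_sum_weight_concat_eq (hp : p ≠ 2) (hG : G.IsTree)
    (hdeg : ∀ x, (G.neighborSet x).ncard = 3) (hJ : ‖J‖ < 1)
    (hc : ∀ x, ‖c x‖ < 1) (hη : ∀ i, ‖η i‖ < 1) (hh : ∀ x i, h x i = c x + η i)
    {k : ℚ_[p]} (hk : k ≠ 0)
    (hb : ∀ i, branch (NormedSpace.exp J) (fun i => NormedSpace.exp (η i)) i ^ 2 =
      k * NormedSpace.exp (η i)) {n : ℕ} (hn : 1 ≤ n) :
    ∃ D : ℚ_[p], D ≠ 0 ∧ ∀ σ : ball G x₀ n → Fin q,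
      ∑ᶠ ω : sphere G x₀ (n + 1) → Fin q, weight G x₀ J h (concat G x₀ σ ω) =
        D * weight G x₀ J h σ := by
  have hfin := finite_neighborSet hdeg
  have := (finite_ball (x₀ := x₀) hG hfin n).to_subtype
  have := (finite_sphere (x₀ := x₀) hG hfin n).fintype
  have := (finite_sphere (x₀ := x₀) hG hfin (n + 1)).fintype
  have hprod : ∀ n [Fintype (sphere G x₀ n)],
      (∏ x : sphere G x₀ n, NormedSpace.exp (c x)) ≠ 0 :=
    fun n _ => Finset.prod_ne_zero_iff.2 fun x _ => exp_ne_zero hp (hc x)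
  refine ⟨(∏ x : sphere G x₀ (n + 1), NormedSpace.exp (c x)) *
    (∏ x : sphere G x₀ n, NormedSpace.exp (c x))⁻¹ * k ^ Fintype.card (sphere G x₀ n),
    mul_ne_zero (mul_ne_zero (hprod _) (inv_ne_zero (hprod _))) (pow_ne_zero _ hk), fun σ => ?_⟩
  rw [sum_weight_concat hp hG hdeg hn hJ hc hη hh, weight_eq_exp_mul_prod hp hJ hc hη hh]
  simp only [hb]
  rw [Finset.prod_mul_distrib, Finset.prod_const, Finset.card_univ]
  have := hprod n
  field_simp

theorem partitionFunction_ne_zero (hp : p ≠ 2) (hG : G.IsTree)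
    (hdeg : ∀ x, (G.neighborSet x).ncard = 3) (hJ : ‖J‖ < 1)
    (hc : ∀ x, ‖c x‖ < 1) (hη : ∀ i, ‖η i‖ < 1) (hh : ∀ x i, h x i = c x + η i)
    {k : ℚ_[p]} (hk : k ≠ 0)
    (hb : ∀ i, branch (NormedSpace.exp J) (fun i => NormedSpace.exp (η i)) i ^ 2 =
      k * NormedSpace.exp (η i))
    (hs : ∑ j, branch (NormedSpace.exp J) (fun i => NormedSpace.exp (η i)) j ^ 3 ≠ 0)
    {n : ℕ} (hn : 1 ≤ n) : partitionFunction G x₀ J h n ≠ 0 := by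
  have hfin := finite_neighborSet hdeg
  induction n, hn using Nat.le_induction with
  | base =>
    have := (finite_sphere (x₀ := x₀) hG hfin 1).fintype
    rw [partitionFunction_one hp hG hdeg hJ hc hη hh]
    exact mul_ne_zero (Finset.prod_ne_zero_iff.2 fun x _ => exp_ne_zero hp (hc x)) hs
  | succ n hn ih =>
    have := (finite_ball (x₀ := x₀) hG hfin n).to_subtype
    have := (finite_ball (x₀ := x₀) hG hfin (n + 1)).to_subtype
    have := (finite_sphere (x₀ := x₀) hG hfin (n + 1)).to_subtype
    obtain ⟨D, hD, h1⟩ := exists_sum_weight_concat_eq (x₀ := x₀) hp hG hdeg hJ hc hη hh hk hb hn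
    rw [partitionFunction_succ, finsum_congr h1, ← mul_finsum]
    exact mul_ne_zero hD ih

theorem finiteDistribution_compatible (hp : p ≠ 2) (hG : G.IsTree)
    (hdeg : ∀ x, (G.neighborSet x).ncard = 3) (hJ : ‖J‖ < 1)
    (hc : ∀ x, ‖c x‖ < 1) (hη : ∀ i, ‖η i‖ < 1) (hh : ∀ x i, h x i = c x + η i)
    {k : ℚ_[p]} (hk : k ≠ 0)
    (hb : ∀ i, branch (NormedSpace.exp J) (fun i => NormedSpace.exp (η i)) i ^ 2 =
      k * NormedSpace.exp (η i)) {n : ℕ} (hn : 1 ≤ n) (σ : ball G x₀ n → Fin q) :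
    ∑ᶠ ω : sphere G x₀ (n + 1) → Fin q, finiteDistribution G x₀ J h (concat G x₀ σ ω) =
      finiteDistribution G x₀ J h σ := by
  have hfin := finite_neighborSet hdeg
  have := (finite_ball (x₀ := x₀) hG hfin n).to_subtype
  have := (finite_ball (x₀ := x₀) hG hfin (n + 1)).to_subtype
  have := (finite_sphere (x₀ := x₀) hG hfin (n + 1)).to_subtype
  obtain ⟨D, hD, h1⟩ := exists_sum_weight_concat_eq (x₀ := x₀) hp hG hdeg hJ hc hη hh hk hb hn
  simp only [finiteDistribution]
  rw [← mul_finsum, h1, partitionFunction_succ, finsum_congr h1,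
    ← mul_finsum, ← partitionFunction, mul_inv]
  field_simp

/-- The Gibbs measure of a boundary field whose reduced field does not depend on the vertex and
solves the fixed point equation. -/
theorem exists_isGibbsMeasure (hp : p ≠ 2) (hG : G.IsTree)
    (hdeg : ∀ x, (G.neighborSet x).ncard = 3) (hJ : ‖J‖ < 1)
    (hc : ∀ x, ‖c x‖ < 1) (hη : ∀ i, ‖η i‖ < 1) (hh : ∀ x i, h x i = c x + η i)
    {k : ℚ_[p]} (hk : k ≠ 0)
    (hb : ∀ i, branch (NormedSpace.exp J) (fun i => NormedSpace.exp (η i)) i ^ 2 =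
      k * NormedSpace.exp (η i))
    (hs : ∑ j, branch (NormedSpace.exp J) (fun i => NormedSpace.exp (η i)) j ^ 3 ≠ 0) :
    ∃ μ, IsGibbsMeasure G x₀ J h μ := by
  have hfin := finite_neighborSet hdeg
  have hZ := fun n hn => partitionFunction_ne_zero (n := n) (x₀ := x₀) hp hG hdeg hJ hc hη hh hk
    hb hs hn
  have hcomp := fun n hn σ => finiteDistribution_compatible (n := n) (x₀ := x₀) hp hG hdeg hJ hc
    hη hh hk hb hn σ
  -- A filler spin for the extension exists, because the sum of cubes would be empty for q = 0.
  have hd : Nonempty (Fin q) := by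
    by_contra hne
    rw [not_nonempty_iff] at hne
    exact hs (Finset.sum_of_isEmpty _)
  obtain ⟨d⟩ := hd
  have := (finite_ball (x₀ := x₀) hG hfin 1).to_subtype
  obtain ⟨μ, h1, h2⟩ := exists_padicMeasure (finite_ball (x₀ := x₀) hG hfin) d
    (f := fun n σ => finiteDistribution G x₀ J h σ) hcomp (by
      simp only [finiteDistribution]
      rw [← mul_finsum, ← partitionFunction, inv_mul_cancel₀ (hZ 1 le_rfl)])
  exact ⟨μ, fun x i => (norm_lt_expRadius_iff hp).2 (hh x i ▸ norm_add_lt_one (hc x) (hη i)), hZ,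
    hcomp, h1, h2⟩

/-- Fields with the same reduced field have the same Gibbs measure. -/
theorem IsGibbsMeasure.unique (hp : p ≠ 2) (hG : G.IsTree)
    (hdeg : ∀ x, (G.neighborSet x).ncard = 3) (hJ : ‖J‖ < 1) {h' : V → Fin q → ℚ_[p]}
    {c' : V → ℚ_[p]} (hc : ∀ x, ‖c x‖ < 1) (hc' : ∀ x, ‖c' x‖ < 1) (hη : ∀ i, ‖η i‖ < 1)
    (hh : ∀ x i, h x i = c x + η i) (hh' : ∀ x i, h' x i = c' x + η i)
    {μ μ' : PadicMeasure p (cylinders V q)} (hμ : IsGibbsMeasure G x₀ J h μ)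
    (hμ' : IsGibbsMeasure G x₀ J h' μ') : μ = μ' := by
  have hfin := finite_ball (x₀ := x₀) hG (finite_neighborSet hdeg)
  refine PadicMeasure.ext_of_cylinderOf hfin fun n hn σ A hA => ?_
  rw [hμ.extends_distribution n hn σ A hA, hμ'.extends_distribution n hn σ A hA]
  have := (hfin n).to_subtype
  have := (finite_sphere (x₀ := x₀) hG (finite_neighborSet hdeg) n).fintype
  have hprod : ∀ {c : V → ℚ_[p]}, (∀ x, ‖c x‖ < 1) →
      (∏ x : sphere G x₀ n, NormedSpace.exp (c x)) ≠ 0 :=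
    fun hc => Finset.prod_ne_zero_iff.2 fun x _ => exp_ne_zero hp (hc x)
  have hp1 := hprod hc
  have hp2 := hprod hc'
  have key : ∀ σ : ball G x₀ n → Fin q, weight G x₀ J h σ =
      ((∏ x : sphere G x₀ n, NormedSpace.exp (c x)) *
        (∏ x : sphere G x₀ n, NormedSpace.exp (c' x))⁻¹) * weight G x₀ J h' σ := by
    intro σ
    rw [weight_eq_exp_mul_prod hp hJ hc hη hh, weight_eq_exp_mul_prod hp hJ hc' hη hh']
    field_simp
  rw [finiteDistribution, finiteDistribution, partitionFunction, finsum_congr key,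
    ← mul_finsum, key, ← partitionFunction]
  field_simp

/-- A Gibbs measure determines the reduced field. -/
theorem IsGibbsMeasure.exp_field_mul_eq (hp : p ≠ 2) (hG : G.IsTree)
    (hdeg : ∀ x, (G.neighborSet x).ncard = 3) (hJ : ‖J‖ < 1) {h' : V → Fin q → ℚ_[p]}
    {c' : V → ℚ_[p]} {η' : Fin q → ℚ_[p]} (hc : ∀ x, ‖c x‖ < 1) (hc' : ∀ x, ‖c' x‖ < 1)
    (hη : ∀ i, ‖η i‖ < 1) (hη' : ∀ i, ‖η' i‖ < 1)
    (hh : ∀ x i, h x i = c x + η i) (hh' : ∀ x i, h' x i = c' x + η' i)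
    {μ : PadicMeasure p (cylinders V q)} (hμ : IsGibbsMeasure G x₀ J h μ)
    (hμ' : IsGibbsMeasure G x₀ J h' μ) (i j : Fin q) :
    NormedSpace.exp (η i) * NormedSpace.exp (η' j) =
      NormedSpace.exp (η j) * NormedSpace.exp (η' i) := by
  classical
  have hfin := finite_ball (x₀ := x₀) hG (finite_neighborSet hdeg)
  have := (hfin 1).to_subtype
  have := (finite_sphere (x₀ := x₀) hG (finite_neighborSet hdeg) 1).fintype
  have : Nonempty (sphere G x₀ 1) := (sphere_nonempty hG hdeg 1).to_subtype
  have hprod : ∀ {c : V → ℚ_[p]}, (∀ x, ‖c x‖ < 1) →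
      (∏ x : sphere G x₀ 1, NormedSpace.exp (c x)) ≠ 0 :=
    fun hc => Finset.prod_ne_zero_iff.2 fun x _ => exp_ne_zero hp (hc x)
  refine mul_eq_mul_of_prod_proportional (ι := sphere G x₀ 1)
    (f := fun i => NormedSpace.exp (η i)) (g := fun i => NormedSpace.exp (η' i))
    (mul_ne_zero (inv_ne_zero (hμ.normalizable 1 le_rfl)) (hprod hc))
    (mul_ne_zero (inv_ne_zero (hμ'.normalizable 1 le_rfl)) (hprod hc'))
    (fun i => exp_ne_zero hp (hη' i)) (fun ρ => ?_) i j
  let σ : ball G x₀ 1 → Fin q := fun x => if hx : (x : V) ∈ sphere G x₀ 1 then ρ ⟨x, hx⟩ else i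
  have hσ : ∀ x : sphere G x₀ 1, σ ⟨x, sphere_subset_ball G x₀ 1 x.2⟩ = ρ x :=
    fun x => dif_pos x.2
  let A : cylinders V q := ⟨cylinderOf G x₀ σ,
    mem_cylinders_of_isDetermined (hfin 1) (isDetermined_cylinderOf σ)⟩
  have h1 := (hμ.extends_distribution 1 le_rfl σ A rfl).symm.trans
    (hμ'.extends_distribution 1 le_rfl σ A rfl)
  simp only [finiteDistribution] at h1
  rw [weight_eq_exp_mul_prod hp hJ hc hη hh, weight_eq_exp_mul_prod hp hJ hc' hη' hh'] at h1
  simp only [hσ] at h1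
  refine mul_left_cancel₀ (exp_ne_zero hp (norm_hamiltonian_lt_one hJ σ)) ?_
  linear_combination h1

end Gibbs

end PadicPotts

namespace PadicPotts

/-! ### Solutions of the fixed point equation -/

section FixedPoints

variable {p : ℕ} [hpp : Fact p.Prime]

/-- The square roots `s` of the nontrivial solutions `s ^ 2` of the fixed point equation in the
ball of radius one around `1`; here `t = θ - 1`. -/
def fixedPoints (t q m : ℚ_[p]) : Set ℚ_[p] :=
  {s | m * s ^ 2 - t * s + (q - m) = 0 ∧ ‖s ^ 2 - 1‖ < 1 ∧ s ^ 2 ≠ 1 ∧ t ≠ 0}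

/-- The fixed points for which the normalizing factors do not vanish. -/
def admissiblePoints (t q m : ℚ_[p]) : Set ℚ_[p] :=
  {s | s ∈ fixedPoints t q m ∧ m * s ^ 3 + (q - m) ≠ 0}

theorem ne_zero_of_mem_fixedPoints {t q m s : ℚ_[p]} (hs : s ∈ fixedPoints t q m) : s ≠ 0 := by
  have := ne_zero_of_norm_sub_one_lt hs.2.1
  exact fun h => this (by rw [h]; ring)

/-- The equation gives t s = m s² + (q - m) with t ≠ 0, so s is a function of s²; counting s is
counting fields. -/
theorem eq_of_sq_eq_of_mem_fixedPoints {t q m s s' : ℚ_[p]} (hs : s ∈ fixedPoints t q m)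
    (hs' : s' ∈ fixedPoints t q m) (h : s ^ 2 = s' ^ 2) : s = s' := by
  refine mul_left_cancel₀ hs.2.2.2 ?_
  linear_combination hs'.1 - hs.1 + m * h

end FixedPoints

/-! ### From Gibbs measures to pairs (M, s) -/

section Spins

variable {p : ℕ} [hpp : Fact p.Prime] {q : ℕ}

theorem sum_ite_mem (M : Finset (Fin q)) (z w : ℚ_[p]) :
    ∑ i, (if i ∈ M then z else w) = M.card * z + (q - M.card) * w := by
  have h : ∀ i, (if i ∈ M then z else w) = (if i ∈ M then z - w else 0) + w := by
    intro i
    split_ifs <;> ring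
  rw [Finset.sum_congr rfl fun i _ => h i, Finset.sum_add_distrib, Finset.sum_ite_mem,
    Finset.univ_inter, Finset.sum_const, Finset.sum_const, Finset.card_univ, Fintype.card_fin,
    nsmul_eq_mul, nsmul_eq_mul]
  ring

theorem branch_ite (θ z : ℚ_[p]) (M : Finset (Fin q)) (j : Fin q) :
    branch θ (fun i => if i ∈ M then z else 1) j =
      if j ∈ M then (θ - 1) * z + (M.card * z + (q - M.card))
        else (θ - 1) + (M.card * z + (q - M.card)) := by
  rw [branch, sum_ite_mem]
  split_ifs <;> ring

theorem exists_mem_of_card {m : ℕ} (hm : 1 ≤ m) {M : Finset (Fin q)} (hM : M.card = m) :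
    ∃ i, i ∈ M :=
  Finset.card_pos.1 (by omega)

theorem exists_notMem_of_card {m : ℕ} (hmq : m < q) {M : Finset (Fin q)} (hM : M.card = m) :
    ∃ i, i ∉ M := by
  by_contra! h
  have := Finset.card_le_card (fun i _ => h i : Finset.univ ⊆ M)
  rw [Finset.card_univ, Fintype.card_fin] at this
  omega

theorem exists_admissiblePoint {m : ℕ} (hm : 1 ≤ m) (hmq : m < q) {M : Finset (Fin q)}
    (hM : M.card = m) {θ z : ℚ_[p]} (hz : ‖z - 1‖ < 1) (hz1 : z ≠ 1)
    (hb : ∀ i j, branch θ (fun i => if i ∈ M then z else 1) i ^ 2 * (if j ∈ M then z else 1) =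
      branch θ (fun i => if i ∈ M then z else 1) j ^ 2 * (if i ∈ M then z else 1))
    (hs : ∑ j, branch θ (fun i => if i ∈ M then z else 1) j ^ 3 ≠ 0) :
    ∃ s ∈ admissiblePoints (θ - 1) (q : ℚ_[p]) m, s ^ 2 = z := by
  obtain ⟨i, hi⟩ := exists_mem_of_card hm hM
  obtain ⟨j, hj⟩ := exists_notMem_of_card hmq hM
  have hbij := hb i j
  simp only [branch_ite, hi, hj, if_true, if_false, hM, mul_one, ite_pow, sum_ite_mem] at hbij hs
  set S : ℚ_[p] := m * z + (q - m) with hS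
  set A := (θ - 1) * z + S with hA
  set B := (θ - 1) + S with hB
  -- If B = 0 then A = 0 too, and the sum of cubes vanishes.
  have hB0 : B ≠ 0 := by
    intro h0
    rw [h0] at hbij hs
    have : A = 0 := by simpa using hbij
    rw [this] at hs
    simp at hs
  -- If θ = 1 then A = B, and the proportionality forces z = 1.
  have ht : θ - 1 ≠ 0 := by
    intro h0
    rw [hA, hB, h0, zero_mul, zero_add] at hbij
    rw [hB, h0, zero_add] at hB0
    exact hz1 (mul_left_cancel₀ (pow_ne_zero 2 hB0) (by linear_combination -hbij))
  obtain ⟨s, hs'⟩ : ∃ s, A = s * B := ⟨A / B, (div_mul_cancel₀ A hB0).symm⟩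
  have hsz : s ^ 2 = z := by
    refine mul_right_cancel₀ (pow_ne_zero 2 hB0) ?_
    rw [← mul_pow, ← hs', hbij]
    ring
  have hs1 : s - 1 ≠ 0 := by
    intro h0
    refine hz1 ?_
    rw [← hsz, sub_eq_zero.1 h0, one_pow]
  refine ⟨s, ⟨⟨?_, by rwa [hsz], by rwa [hsz], ht⟩, fun h0 => hs ?_⟩, hsz⟩
  -- The cubic sB - A factors as (s - 1)(m s² - t s + (q - m)).
  · refine mul_left_cancel₀ hs1 ?_
    rw [hA, hB, hS, ← hsz] at hs'
    linear_combination -hs'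
  · rw [hs']
    linear_combination B ^ 3 * h0

/-- The quadratic equation says that the sum of the ζ_i equals t s. The square of `branch` is then
(t(1 + s))² ζ, as compatibility demands. -/
theorem branch_of_mem_fixedPoints {θ s : ℚ_[p]} {M : Finset (Fin q)}
    (hs : s ∈ fixedPoints (θ - 1) (q : ℚ_[p]) M.card) (j : Fin q) :
    branch θ (fun i => if i ∈ M then s ^ 2 else 1) j =
      (θ - 1) * (1 + s) * if j ∈ M then s else 1 := by
  rw [branch_ite]
  split_ifs
  · linear_combination hs.1
  · linear_combination hs.1

theorem one_add_ne_zero_of_mem_fixedPoints {t a b s : ℚ_[p]} (hs : s ∈ fixedPoints t a b) :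
    1 + s ≠ 0 := by
  intro h
  refine hs.2.2.1 ?_
  linear_combination (s - 1) * h

/-- The field `c_x + a 1_M` with `exp a = s ^ 2` has the Gibbs measure `μ`. -/
def Represents {V : Type*} (G : SimpleGraph V) (x₀ : V) (J : ℚ_[p]) (M : Finset (Fin q))
    (s : ℚ_[p]) (μ : PadicMeasure p (cylinders V q)) : Prop :=
  ∃ (h : V → Fin q → ℚ_[p]) (c : V → ℚ_[p]) (a : ℚ_[p]), (∀ x, ‖c x‖ < 1) ∧ ‖a‖ < 1 ∧
    NormedSpace.exp a = s ^ 2 ∧ (∀ x i, h x i = c x + if i ∈ M then a else 0) ∧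
    IsGibbsMeasure G x₀ J h μ

variable {V : Type*} {G : SimpleGraph V} {x₀ : V} {J : ℚ_[p]}

theorem norm_ite_lt_one {a : ℚ_[p]} (ha : ‖a‖ < 1) (P : Prop) [Decidable P] :
    ‖if P then a else 0‖ < 1 := by
  split_ifs
  · exact ha
  · simp

theorem exp_ite (a : ℚ_[p]) (P : Prop) [Decidable P] :
    NormedSpace.exp (if P then a else 0) = if P then NormedSpace.exp a else 1 := by
  split_ifs
  · rfl
  · exact NormedSpace.exp_zero

theorem mem_tiGibbsMeasures_iff (hp : p ≠ 2) (hG : G.IsTree)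
    (hdeg : ∀ x, (G.neighborSet x).ncard = 3) {m : ℕ} (hm : 1 ≤ m) (hmq : m < q) (hJ : ‖J‖ < 1)
    {μ : PadicMeasure p (cylinders V q)} :
    μ ∈ tiGibbsMeasures G x₀ J q m ↔ ∃ M : Finset (Fin q), M.card = m ∧
      ∃ s ∈ admissiblePoints (NormedSpace.exp J - 1) (q : ℚ_[p]) m, Represents G x₀ J M s μ := by
  constructor
  · rintro ⟨h, -, ⟨M, hM, a, ha0, c, hh⟩, hμ⟩
    have hn : ∀ x i, ‖h x i‖ < 1 := fun x i => (norm_lt_expRadius_iff hp).1 (hμ.field_mem x i)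
    obtain ⟨i, hi⟩ := exists_mem_of_card hm hM
    obtain ⟨j, hj⟩ := exists_notMem_of_card hmq hM
    -- A spin outside M exhibits c_x as a value of h, and a spin in M then exhibits a as a
    -- difference, so both lie in the domain of `exp_p`.
    have hc : ∀ x, ‖c x‖ < 1 := fun x => by
      have := hn x j
      rwa [hh, if_neg hj, add_zero] at this
    have ha : ‖a‖ < 1 := by
      have := norm_sub_lt_one (hn x₀ i) (hc x₀)
      rwa [hh, if_pos hi, add_sub_cancel_left] at this
    have hη := fun i : Fin q => norm_ite_lt_one ha (i ∈ M)
    have h1 := branch_sq_proportional hp hG hdeg hJ hc hη hh hμ.normalizable hμ.compatible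
    have h2 := sum_branch_cube_ne_zero hp hG hdeg hJ hc hη hh (hμ.normalizable 1 le_rfl)
    simp only [exp_ite] at h1 h2
    obtain ⟨s, hs, hsa⟩ := exists_admissiblePoint hm hmq hM
      (by rwa [norm_exp_sub_one hp ha]) (fun h0 => ha0 (exp_injOn hp ha (by simp)
        (h0.trans NormedSpace.exp_zero.symm))) h1 h2
    exact ⟨M, hM, s, hs, h, c, a, hc, ha, hsa.symm, hh, hμ⟩
  · rintro ⟨M, hM, s, hs, h, c, a, hc, ha, hsa, hh, hμ⟩
    refine ⟨h, fun x y i j => ?_, ⟨M, hM, a, ?_, c, hh⟩, hμ⟩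
    · simp only [hh]
      ring
    · rintro rfl
      exact hs.1.2.2.1 (hsa.symm.trans NormedSpace.exp_zero)

theorem exists_represents (hp : p ≠ 2) (hG : G.IsTree)
    (hdeg : ∀ x, (G.neighborSet x).ncard = 3) (hJ : ‖J‖ < 1) {M : Finset (Fin q)} {s : ℚ_[p]}
    (hs : s ∈ admissiblePoints (NormedSpace.exp J - 1) (q : ℚ_[p]) M.card) :
    ∃ μ, Represents G x₀ J M s μ := by
  obtain ⟨a, ha, hsa⟩ := exists_exp_eq hp hs.1.2.1
  have hB := mul_ne_zero hs.1.2.2.2 (one_add_ne_zero_of_mem_fixedPoints hs.1)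
  have hη := fun i : Fin q => norm_ite_lt_one ha (i ∈ M)
  obtain ⟨μ, hμ⟩ := exists_isGibbsMeasure (x₀ := x₀) (c := fun _ => 0)
    (k := ((NormedSpace.exp J - 1) * (1 + s)) ^ 2) hp hG hdeg hJ (by simp) hη
    (h := fun _ i => 0 + if i ∈ M then a else 0) (fun _ _ => rfl) (pow_ne_zero 2 hB) (by
      intro i
      simp only [exp_ite, hsa]
      rw [branch_of_mem_fixedPoints hs.1]
      split_ifs <;> ring) (by
      simp only [exp_ite, hsa, branch_of_mem_fixedPoints hs.1, mul_pow, ite_pow]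
      rw [← Finset.mul_sum, sum_ite_mem]
      rw [← mul_pow]
      refine mul_ne_zero (pow_ne_zero 3 hB) ?_
      rw [one_pow, mul_one]
      exact hs.2)
  exact ⟨μ, _, _, a, by simp, ha, hsa, fun _ _ => rfl, hμ⟩

theorem Represents.unique (hp : p ≠ 2) (hG : G.IsTree)
    (hdeg : ∀ x, (G.neighborSet x).ncard = 3) (hJ : ‖J‖ < 1) {M : Finset (Fin q)} {s : ℚ_[p]}
    {μ μ' : PadicMeasure p (cylinders V q)} (hμ : Represents G x₀ J M s μ)
    (hμ' : Represents G x₀ J M s μ') : μ = μ' := by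
  obtain ⟨h, c, a, hc, ha, hsa, hh, hg⟩ := hμ
  obtain ⟨h', c', a', hc', ha', hsa', hh', hg'⟩ := hμ'
  obtain rfl := exp_injOn hp ha ha' (hsa.trans hsa'.symm)
  exact IsGibbsMeasure.unique hp hG hdeg hJ hc hc' (fun i => norm_ite_lt_one ha (i ∈ M)) hh hh'
    hg hg'

/-- Rests on c_x + a·1_M = (c_x + a) - a·1_{Mᶜ}. -/
theorem Represents.compl (hp : p ≠ 2) {M : Finset (Fin q)} {s s' : ℚ_[p]}
    {μ : PadicMeasure p (cylinders V q)} (hμ : Represents G x₀ J M s μ) (hs : s ^ 2 * s' ^ 2 = 1) :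
    Represents G x₀ J Mᶜ s' μ := by
  obtain ⟨h, c, a, hc, ha, hsa, hh, hg⟩ := hμ
  refine ⟨h, fun x => c x + a, -a, fun x => norm_add_lt_one (hc x) ha, by rwa [norm_neg], ?_,
    fun x i => ?_, hg⟩
  · rw [exp_neg hp ha, hsa]
    exact inv_eq_of_mul_eq_one_right hs
  · rw [hh]
    by_cases hi : i ∈ M <;> simp [hi]

/-- The reduced field separates two spins exactly when one of them lies in M, so the measure
determines the partition {M, Mᶜ}; whether M' contains i₀ decides between the two cases. -/
theorem Represents.eq_or_compl (hp : p ≠ 2) (hG : G.IsTree)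
    (hdeg : ∀ x, (G.neighborSet x).ncard = 3) (hJ : ‖J‖ < 1) {M M' : Finset (Fin q)}
    {s s' : ℚ_[p]} {μ : PadicMeasure p (cylinders V q)} (hM : ∃ i, i ∈ M) (hM' : ∃ i, i ∉ M)
    (hs : s ^ 2 ≠ 1) (hμ : Represents G x₀ J M s μ) (hμ' : Represents G x₀ J M' s' μ) :
    (M' = M ∧ s ^ 2 = s' ^ 2) ∨ (M' = Mᶜ ∧ s ^ 2 * s' ^ 2 = 1) := by
  obtain ⟨h, c, a, hc, ha, hsa, hh, hg⟩ := hμ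
  obtain ⟨h', c', a', hc', ha', hsa', hh', hg'⟩ := hμ'
  obtain ⟨i₀, hi₀⟩ := hM
  obtain ⟨j₀, hj₀⟩ := hM'
  have key := IsGibbsMeasure.exp_field_mul_eq hp hG hdeg hJ hc hc'
    (fun i => norm_ite_lt_one ha (i ∈ M)) (fun i => norm_ite_lt_one ha' (i ∈ M')) hh hh' hg hg'
  have hz := exp_ne_zero hp ha
  have hz' := exp_ne_zero hp ha'
  have hz1 : NormedSpace.exp a ≠ 1 := by rwa [hsa]
  simp only [exp_ite] at key
  rw [← hsa, ← hsa']
  have hz1' : NormedSpace.exp a' ≠ 1 := by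
    intro h0
    have := key i₀ j₀
    simp only [h0, hi₀, hj₀, ite_self, if_true, if_false, mul_one] at this
    exact hz1 this
  by_cases hi : i₀ ∈ M'
  · have hMM : M' = M := by
      ext j
      have := key i₀ j
      by_cases h1 : j ∈ M <;> by_cases h2 : j ∈ M' <;> simp_all
    refine Or.inl ⟨hMM, ?_⟩
    have := key i₀ j₀
    rw [hMM] at this
    simpa [hi₀, hj₀] using this
  · have hMM : M' = Mᶜ := by
      ext j
      rw [Finset.mem_compl]
      have := key i₀ j
      by_cases h1 : j ∈ M <;> by_cases h2 : j ∈ M' <;> simp_all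
    refine Or.inr ⟨hMM, ?_⟩
    have := key i₀ j₀
    rw [hMM] at this
    simpa [hi₀, hj₀] using this

/-- Here R is a set of representatives of the admissible s modulo complementation, so that q = 2m
and q ≠ 2m are treated alike. -/
theorem encard_tiGibbsMeasures_of_forall (hp : p ≠ 2) (hG : G.IsTree)
    (hdeg : ∀ x, (G.neighborSet x).ncard = 3) {m : ℕ} (hm : 1 ≤ m) (hmq : m < q) (hJ : ‖J‖ < 1)
    (R : Set ℚ_[p]) (hR : R ⊆ admissiblePoints (NormedSpace.exp J - 1) (q : ℚ_[p]) m)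
    (hsurj : ∀ M : Finset (Fin q), M.card = m →
      ∀ s ∈ admissiblePoints (NormedSpace.exp J - 1) (q : ℚ_[p]) m, ∀ μ, Represents G x₀ J M s μ →
        ∃ M' : Finset (Fin q), M'.card = m ∧ ∃ s' ∈ R, Represents G x₀ J M' s' μ)
    (hinj : q = 2 * m → ∀ s ∈ R, ∀ s' ∈ R, s ^ 2 * s' ^ 2 ≠ 1) :
    (tiGibbsMeasures G x₀ J q m).encard = q.choose m * R.encard := by
  classical
  let P : Set (Finset (Fin q) × ℚ_[p]) :=
    (Finset.powersetCard m Finset.univ : Finset (Finset (Fin q))) ×ˢ R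
  have hP : ∀ x ∈ P, x.1.card = m ∧ x.2 ∈ R := fun x hx =>
    ⟨(Finset.mem_powersetCard.1 (Finset.mem_coe.1 hx.1)).2, hx.2⟩
  have hex : ∀ x : Finset (Fin q) × ℚ_[p], ∃ μ, x ∈ P → Represents G x₀ J x.1 x.2 μ := by
    intro x
    by_cases hx : x ∈ P
    · obtain ⟨h1, h2⟩ := hP x hx
      obtain ⟨μ, hμ⟩ := exists_represents (x₀ := x₀) (M := x.1) hp hG hdeg hJ (by rw [h1]; exact hR h2)
      exact ⟨μ, fun _ => hμ⟩
    · exact ⟨⟨fun _ => 0, fun _ _ _ _ _ => by simp⟩, fun h => absurd h hx⟩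
  choose Φ hΦ using hex
  have himg : tiGibbsMeasures G x₀ J q m = Φ '' P := by
    ext μ
    rw [mem_tiGibbsMeasures_iff hp hG hdeg hm hmq hJ]
    constructor
    · rintro ⟨M, hM, s, hs, hμ⟩
      obtain ⟨M', hM', s', hs', hμ'⟩ := hsurj M hM s hs μ hμ
      have hx : (M', s') ∈ P :=
        ⟨Finset.mem_coe.2 (Finset.mem_powersetCard.2 ⟨Finset.subset_univ _, hM'⟩), hs'⟩
      exact ⟨(M', s'), hx, Represents.unique hp hG hdeg hJ (hΦ _ hx) hμ'⟩
    · rintro ⟨x, hx, rfl⟩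
      exact ⟨x.1, (hP x hx).1, x.2, hR (hP x hx).2, hΦ x hx⟩
  have hinjOn : Set.InjOn Φ P := by
    intro x hx y hy hxy
    obtain ⟨h1, h2⟩ := hP x hx
    obtain ⟨h3, h4⟩ := hP y hy
    have hy' := hΦ y hy
    rw [← hxy] at hy'
    rcases Represents.eq_or_compl hp hG hdeg hJ (exists_mem_of_card hm h1)
      (exists_notMem_of_card hmq h1) (hR h2).1.2.2.1 (hΦ x hx) hy' with ⟨h5, h6⟩ | ⟨h5, h6⟩
    · exact Prod.ext h5.symm (eq_of_sq_eq_of_mem_fixedPoints (hR h2).1 (hR h4).1 h6)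
    · exfalso
      have h7 := congrArg Finset.card h5
      rw [Finset.card_compl, Fintype.card_fin, h1, h3] at h7
      exact hinj (by omega) _ h2 _ h4 h6
  rw [himg, hinjOn.encard_image, Set.encard_prod, Set.encard_coe_eq_coe_finsetCard,
    Finset.card_powersetCard, Finset.card_univ, Fintype.card_fin]

theorem encard_tiGibbsMeasures (hp : p ≠ 2) (hG : G.IsTree)
    (hdeg : ∀ x, (G.neighborSet x).ncard = 3) {m : ℕ} (hm : 1 ≤ m) (hmq : m < q) (hJ : ‖J‖ < 1)
    (hq : q ≠ 2 * m) : (tiGibbsMeasures G x₀ J q m).encard =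
      q.choose m * (admissiblePoints (NormedSpace.exp J - 1) (q : ℚ_[p]) m).encard :=
  encard_tiGibbsMeasures_of_forall hp hG hdeg hm hmq hJ _ subset_rfl
    (fun M hM s hs _ hμ => ⟨M, hM, s, hs, hμ⟩) fun h => absurd h hq

theorem encard_tiGibbsMeasures_two_mul (hp : p ≠ 2) (hG : G.IsTree)
    (hdeg : ∀ x, (G.neighborSet x).ncard = 3) {m : ℕ} (hm : 1 ≤ m) (hmq : m < q) (hJ : ‖J‖ < 1)
    (hq : q = 2 * m)
    (hne : (admissiblePoints (NormedSpace.exp J - 1) (q : ℚ_[p]) m).Nonempty) :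
    (tiGibbsMeasures G x₀ J q m).encard = q.choose m := by
  obtain ⟨s₀, hs₀⟩ := hne
  have hm0 : (m : ℚ_[p]) ≠ 0 := by exact_mod_cast (by omega : m ≠ 0)
  have hqm : (q : ℚ_[p]) = 2 * m := by exact_mod_cast hq
  have hs00 := ne_zero_of_mem_fixedPoints hs₀.1
  rw [encard_tiGibbsMeasures_of_forall hp hG hdeg hm hmq hJ {s₀}
    (Set.singleton_subset_iff.2 hs₀), Set.encard_singleton, mul_one]
  · intro M hM s hs μ hμ
    by_cases h : s = s₀
    · exact ⟨M, hM, s₀, rfl, h ▸ hμ⟩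
    -- Eliminating t from the two quadratic equations leaves m (s - s₀)(s s₀ - 1) = 0.
    · have h1 : s * s₀ = 1 := by
        refine mul_left_cancel₀ (mul_ne_zero hm0 (sub_ne_zero.2 h)) ?_
        have e1 := hs.1.1
        have e2 := hs₀.1.1
        rw [hqm] at e1 e2
        linear_combination s₀ * e1 - s * e2
      refine ⟨Mᶜ, ?_, s₀, rfl, hμ.compl hp (by rw [← mul_pow, h1, one_pow])⟩
      rw [Finset.card_compl, Fintype.card_fin, hM]
      omega
  · rintro - s hs s' hs' h1
    rw [Set.mem_singleton_iff] at hs hs'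
    rw [hs, hs'] at h1
    -- No representative is its own partner: s₀² = -1 would give |s₀² - 1| = |2| = 1.
    have h2 : (s₀ ^ 2 - 1) * (s₀ ^ 2 + 1) = 0 := by linear_combination h1
    have h3 : s₀ ^ 2 + 1 = 0 :=
      (mul_eq_zero.1 h2).resolve_left (sub_ne_zero.2 hs₀.1.2.2.1)
    have h4 := hs₀.1.2.1
    rw [eq_neg_of_add_eq_zero_left h3, ← norm_neg,
      show -(-1 - 1 : ℚ_[p]) = 2 by norm_num, norm_two_eq_one hp] at h4
    exact lt_irrefl _ h4

end Spins

end PadicPotts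

namespace PadicPotts

/-! ### Small roots of a p-adic quadratic -/

section Quadratic

variable {p : ℕ} [hpp : Fact p.Prime]

theorem norm_add_eq_left {x y : ℚ_[p]} (h : ‖y‖ < ‖x‖) : ‖x + y‖ = ‖x‖ := by
  rw [IsUltrametricDist.norm_add_eq_max_of_norm_ne_norm h.ne', max_eq_left h.le]

theorem norm_sub_eq_left {x y : ℚ_[p]} (h : ‖y‖ < ‖x‖) : ‖x - y‖ = ‖x‖ := by
  rw [sub_eq_add_neg]
  exact norm_add_eq_left (by rwa [norm_neg])

theorem norm_add_lt {x y : ℚ_[p]} {r : ℝ} (hx : ‖x‖ < r) (hy : ‖y‖ < r) : ‖x + y‖ < r :=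
  (IsUltrametricDist.norm_add_le_max x y).trans_lt (max_lt hx hy)

theorem norm_sub_lt {x y : ℚ_[p]} {r : ℝ} (hx : ‖x‖ < r) (hy : ‖y‖ < r) : ‖x - y‖ < r := by
  rw [sub_eq_add_neg]
  exact norm_add_lt hx (by rwa [norm_neg])

theorem norm_two_mul (hp : p ≠ 2) (x : ℚ_[p]) : ‖2 * x‖ = ‖x‖ := by
  rw [norm_mul, norm_two_eq_one hp, one_mul]

/-- A quadratic polynomial that reduces to a linear one has a small root. -/
theorem exists_root_of_norm_lt {α β γ : ℚ_[p]} (hα : ‖α‖ ≤ ‖β‖) (hγ : ‖γ‖ < ‖β‖) :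
    ∃ v : ℚ_[p], ‖v‖ < 1 ∧ α * v ^ 2 + β * v + γ = 0 := by
  have hβ : 0 < ‖β‖ := (norm_nonneg γ).trans_lt hγ
  have hβ0 : β ≠ 0 := norm_pos_iff.1 hβ
  -- After division by β the polynomial is integral, has derivative 1 at 0 and a constant term of
  -- norm less than 1; Hensel's lemma applies at 0.
  let A : ℤ_[p] := ⟨α / β, by rw [norm_div]; exact div_le_one_of_le₀ hα hβ.le⟩
  have hC : ‖γ / β‖ < 1 := by rw [norm_div]; exact (div_lt_one hβ).2 hγ
  let C : ℤ_[p] := ⟨γ / β, hC.le⟩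
  let F : Polynomial ℤ_[p] := Polynomial.C A * Polynomial.X ^ 2 + Polynomial.X + Polynomial.C C
  have hF : ∀ z : ℤ_[p], F.aeval z = A * z ^ 2 + z + C := fun z => by simp [F]
  have hF' : F.derivative.aeval (0 : ℤ_[p]) = 1 := by simp [F]
  obtain ⟨z, hz, hz1, -⟩ := hensels_lemma (p := p) (F := F) (a := (0 : ℤ_[p])) (by
    rw [hF', hF, show A * 0 ^ 2 + 0 + C = C by ring, norm_one, one_pow]
    exact hC)
  rw [hF', sub_zero, norm_one] at hz1
  refine ⟨z, hz1, ?_⟩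
  have h1 : α / β * (z : ℚ_[p]) ^ 2 + z + γ / β = 0 := by
    have h2 := congrArg ((↑) : ℤ_[p] → ℚ_[p]) ((hF z).symm.trans hz)
    simpa using h2
  field_simp at h1
  linear_combination h1

/-- The small `v` for which `1 + v` is a root of `m s ^ 2 - t s + (q - m)`. -/
def smallRoots (t q m : ℚ_[p]) : Set ℚ_[p] :=
  {v | ‖v‖ < 1 ∧ m * v ^ 2 + (2 * m - t) * v + (q - t) = 0}

/-- Two distinct small roots w, v would satisfy 2m - t = -m(w + v), whose norm is too small. -/
theorem exists_smallRoots_eq_singleton {t q m : ℚ_[p]} (h1 : ‖m‖ ≤ ‖2 * m - t‖)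
    (h2 : ‖q - t‖ < ‖2 * m - t‖) : ∃ v, smallRoots t q m = {v} := by
  obtain ⟨v, hv, he⟩ := exists_root_of_norm_lt h1 h2
  refine ⟨v, Set.eq_singleton_iff_unique_mem.2 ⟨⟨hv, he⟩, fun w hw => ?_⟩⟩
  by_contra hne
  have h3 : 2 * m - t = -(m * (w + v)) := by
    refine mul_left_cancel₀ (sub_ne_zero.2 hne) ?_
    linear_combination hw.2 - he
  have h4 := congrArg norm h3
  rw [norm_neg, norm_mul] at h4
  have h5 := norm_add_lt_one hw.1 hv
  have h6 : 0 < ‖2 * m - t‖ := (norm_nonneg _).trans_lt h2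
  have h7 : ‖m‖ * ‖w + v‖ < ‖2 * m - t‖ := by
    rcases (norm_nonneg m).eq_or_lt with h0 | h0
    · rwa [← h0, zero_mul]
    · exact (mul_lt_of_lt_one_right h0 h5).trans_le h1
  exact h7.ne' h4

theorem zero_mem_smallRoots {t q m : ℚ_[p]} : (0 : ℚ_[p]) ∈ smallRoots t q m ↔ q = t := by
  simp [smallRoots, sub_eq_zero]

theorem encard_smallRoots_of_ne {t q m : ℚ_[p]} (h1 : ‖m‖ ≤ ‖2 * m - t‖)
    (h2 : ‖q - t‖ < ‖2 * m - t‖) (h : q ≠ t) : (smallRoots t q m \ {0}).encard = 1 := by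
  obtain ⟨v, hv⟩ := exists_smallRoots_eq_singleton h1 h2
  have h0 : (0 : ℚ_[p]) ∉ smallRoots t q m := fun h0 => h (zero_mem_smallRoots.1 h0)
  rw [Set.sdiff_singleton_eq_self h0, hv, Set.encard_singleton]

theorem encard_smallRoots_of_eq {t q m : ℚ_[p]} (h1 : ‖m‖ ≤ ‖2 * m - t‖)
    (h2 : ‖q - t‖ < ‖2 * m - t‖) (h : q = t) : (smallRoots t q m \ {0}).encard = 0 := by
  obtain ⟨v, hv⟩ := exists_smallRoots_eq_singleton h1 h2
  have h0 : (0 : ℚ_[p]) ∈ smallRoots t q m := zero_mem_smallRoots.2 h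
  rw [hv, Set.mem_singleton_iff] at h0
  rw [hv, h0, sdiff_self]
  exact Set.encard_empty

/-- For |v| < 1 the constant term strictly dominates the others. -/
theorem smallRoots_eq_empty {t q m : ℚ_[p]} (h1 : ‖m‖ ≤ ‖q - t‖) (h2 : ‖2 * m - t‖ ≤ ‖q - t‖)
    (h : q ≠ t) : smallRoots t q m = ∅ := by
  rw [Set.eq_empty_iff_forall_notMem]
  rintro v ⟨hv, he⟩
  have h0 : 0 < ‖q - t‖ := norm_pos_iff.2 (sub_ne_zero.2 h)
  have h3 : q - t = -(v * (m * v + (2 * m - t))) := by linear_combination he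
  have h4 := congrArg norm h3
  rw [norm_neg, norm_mul] at h4
  have h5 : ‖m * v + (2 * m - t)‖ ≤ ‖q - t‖ := by
    refine (IsUltrametricDist.norm_add_le_max _ _).trans (max_le ?_ h2)
    rw [norm_mul]
    exact (mul_le_of_le_one_right (norm_nonneg _) hv.le).trans h1
  have h6 : ‖v‖ * ‖m * v + (2 * m - t)‖ ≤ ‖v‖ * ‖q - t‖ :=
    mul_le_mul_of_nonneg_left h5 (norm_nonneg _)
  have h7 : ‖v‖ * ‖q - t‖ < ‖q - t‖ := mul_lt_of_lt_one_left h0 hv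
  linarith

/-- When the leading coefficient strictly dominates, all roots are small, and completing the square
describes them. -/
theorem mem_smallRoots_iff_of_norm_lt {t q m : ℚ_[p]} (h1 : ‖2 * m - t‖ < ‖m‖)
    (h2 : ‖q - t‖ < ‖m‖) {v : ℚ_[p]} : v ∈ smallRoots t q m ↔
      (2 * m * v + (2 * m - t)) ^ 2 = t ^ 2 - 4 * m * (q - m) := by
  have hm : 0 < ‖m‖ := (norm_nonneg _).trans_lt h1
  have hm0 : m ≠ 0 := norm_pos_iff.1 hm
  have h4 : (4 : ℚ_[p]) ≠ 0 := by norm_num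
  have key : (2 * m * v + (2 * m - t)) ^ 2 = t ^ 2 - 4 * m * (q - m) ↔
      m * v ^ 2 + (2 * m - t) * v + (q - t) = 0 := by
    constructor
    · intro h
      refine (mul_eq_zero.1 (?_ : 4 * m * (m * v ^ 2 + (2 * m - t) * v + (q - t)) = 0)).resolve_left
        (mul_ne_zero h4 hm0)
      linear_combination h
    · intro h
      linear_combination 4 * m * h
  rw [key]
  refine ⟨fun h => h.2, fun h => ⟨?_, h⟩⟩
  by_contra hv
  rw [not_lt] at hv
  have h3 : m * v ^ 2 = -((2 * m - t) * v + (q - t)) := by linear_combination h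
  have h5 := congrArg norm h3
  rw [norm_neg, norm_mul, norm_pow] at h5
  have h6 : ‖(2 * m - t) * v + (q - t)‖ < ‖m‖ * ‖v‖ ^ 2 := by
    have h7 : ‖v‖ ≤ ‖v‖ ^ 2 := le_self_pow₀ hv two_ne_zero
    refine norm_add_lt ?_ ?_
    · rw [norm_mul]
      exact (mul_lt_mul_of_pos_right h1 (by linarith)).trans_le
        (mul_le_mul_of_nonneg_left h7 hm.le)
    · exact h2.trans_le (le_mul_of_one_le_right hm.le (hv.trans h7))
  linarith

theorem encard_smallRoots_of_disc {t q m : ℚ_[p]} (h1 : ‖2 * m - t‖ < ‖m‖)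
    (h2 : ‖q - t‖ < ‖m‖) (h : q ≠ t) (hD : t ^ 2 - 4 * m * (q - m) ≠ 0)
    (hsq : IsSquare (t ^ 2 - 4 * m * (q - m))) : (smallRoots t q m \ {0}).encard = 2 := by
  obtain ⟨r, hr⟩ := hsq
  have hr0 : r ≠ 0 := by
    rintro rfl
    exact hD (by rw [hr, zero_mul])
  have hm0 : m ≠ 0 := norm_pos_iff.1 ((norm_nonneg _).trans_lt h1)
  have h0 : (0 : ℚ_[p]) ∉ smallRoots t q m := fun h0 => h (zero_mem_smallRoots.1 h0)
  rw [Set.sdiff_singleton_eq_self h0]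
  have hS : smallRoots t q m = {(r - (2 * m - t)) / (2 * m), (-r - (2 * m - t)) / (2 * m)} := by
    ext v
    rw [mem_smallRoots_iff_of_norm_lt h1 h2, hr, ← sq, sq_eq_sq_iff_eq_or_eq_neg,
      Set.mem_insert_iff, Set.mem_singleton_iff, eq_div_iff (by simpa using hm0),
      eq_div_iff (by simpa using hm0)]
    refine or_congr ?_ ?_ <;> constructor <;> intro h <;> linear_combination h
  rw [hS, Set.encard_pair]
  intro h3
  rw [div_left_inj' (by simpa using hm0)] at h3
  exact hr0 (by linear_combination h3 / 2)

theorem encard_smallRoots_of_disc_eq_zero {t q m : ℚ_[p]}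
    (h1 : ‖2 * m - t‖ < ‖m‖) (h2 : ‖q - t‖ < ‖m‖) (h : q ≠ t)
    (hD : t ^ 2 - 4 * m * (q - m) = 0) : (smallRoots t q m \ {0}).encard = 1 := by
  have hm0 : m ≠ 0 := norm_pos_iff.1 ((norm_nonneg _).trans_lt h1)
  have h0 : (0 : ℚ_[p]) ∉ smallRoots t q m := fun h0 => h (zero_mem_smallRoots.1 h0)
  rw [Set.sdiff_singleton_eq_self h0]
  have hS : smallRoots t q m = {(-(2 * m - t)) / (2 * m)} := by
    ext v
    rw [mem_smallRoots_iff_of_norm_lt h1 h2, hD, sq_eq_zero_iff,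
      Set.mem_singleton_iff, eq_div_iff (by simpa using hm0)]
    constructor <;> intro h <;> linear_combination h
  rw [hS, Set.encard_singleton]

theorem encard_smallRoots_self {q m : ℚ_[p]} (h1 : ‖q - 2 * m‖ < ‖m‖) (h : q ≠ 2 * m) :
    (smallRoots q q m \ {0}).encard = 1 := by
  have hm : 0 < ‖m‖ := (norm_nonneg _).trans_lt h1
  have hm0 : m ≠ 0 := norm_pos_iff.1 hm
  have hS : smallRoots q q m \ {0} = {(q - 2 * m) / m} := by
    ext v
    simp only [smallRoots, Set.mem_sdiff, Set.mem_ofPred_eq, Set.mem_singleton_iff]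
    constructor
    · rintro ⟨⟨-, h2⟩, h3⟩
      rw [eq_div_iff hm0]
      refine mul_left_cancel₀ h3 ?_
      linear_combination h2
    · rintro rfl
      refine ⟨⟨?_, ?_⟩, div_ne_zero (sub_ne_zero.2 h) hm0⟩
      · rwa [norm_div, div_lt_one hm]
      · field_simp
        ring
  rw [hS, Set.encard_singleton]

end Quadratic

/-! ### Splitting fixed points by sign; vanishing normalizing factors -/

section FixedPointCount

variable {p : ℕ} [hpp : Fact p.Prime]

theorem one_add_mem_fixedPoints (hp : p ≠ 2) {t q m ε v : ℚ_[p]} (hε : ε = 1 ∨ ε = -1)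
    (ht : t ≠ 0) (hv : v ∈ smallRoots (ε * t) q m) (h0 : v ≠ 0) :
    ε * (1 + v) ∈ fixedPoints t q m := by
  have hε2 : ε ^ 2 = 1 := by rcases hε with rfl | rfl <;> norm_num
  have h1 : (ε * (1 + v)) ^ 2 - 1 = v * (2 + v) := by
    linear_combination (1 + v) ^ 2 * hε2
  have h2 : ‖2 + v‖ = 1 := by
    rw [norm_add_eq_left (by rw [norm_two_eq_one hp]; exact hv.1), norm_two_eq_one hp]
  refine ⟨?_, ?_, ?_, ht⟩
  · linear_combination hv.2 + m * (1 + v) ^ 2 * hε2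
  · rw [h1, norm_mul, h2, mul_one]
    exact hv.1
  · rw [← sub_ne_zero, h1]
    refine mul_ne_zero h0 (norm_ne_zero_iff.1 ?_)
    rw [h2]
    exact one_ne_zero

theorem exists_smallRoot_of_mem_fixedPoints {t q m s : ℚ_[p]} (hs : s ∈ fixedPoints t q m) :
    ∃ ε : ℚ_[p], (ε = 1 ∨ ε = -1) ∧ ∃ v ∈ smallRoots (ε * t) q m, v ≠ 0 ∧ s = ε * (1 + v) := by
  have h1 : ‖s - 1‖ < 1 ∨ ‖s + 1‖ < 1 := by
    by_contra! h
    have h2 := hs.2.1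
    rw [show s ^ 2 - 1 = (s - 1) * (s + 1) by ring, norm_mul] at h2
    exact absurd h2 (not_lt.2 (one_le_mul_of_one_le_of_one_le h.1 h.2))
  rcases h1 with h1 | h1
  · refine ⟨1, Or.inl rfl, s - 1, ⟨h1, ?_⟩, fun h0 => hs.2.2.1 ?_, by ring⟩
    · linear_combination hs.1
    · linear_combination (s + 1) * h0
  · refine ⟨-1, Or.inr rfl, -(s + 1), ⟨by rwa [norm_neg], ?_⟩, fun h0 => hs.2.2.1 ?_, by ring⟩
    · linear_combination hs.1
    · linear_combination (1 - s) * h0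

/-- The balls around 1 and -1 are disjoint because |2| = 1. Keeping ε free lets the relevant sign be
chosen later. -/
theorem encard_fixedPoints (hp : p ≠ 2) {t q m ε : ℚ_[p]} (hε : ε = 1 ∨ ε = -1) (ht : t ≠ 0) :
    (fixedPoints t q m).encard = (smallRoots (ε * t) q m \ {0}).encard +
      (smallRoots (-(ε * t)) q m \ {0}).encard := by
  have hε0 : ε ≠ 0 := by rcases hε with rfl | rfl <;> norm_num
  have hε' : -ε = 1 ∨ -ε = -1 := by rcases hε with rfl | rfl <;> simp
  have hinj : ∀ {e : ℚ_[p]}, e ≠ 0 → Function.Injective fun v : ℚ_[p] => e * (1 + v) :=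
    fun he v w h => add_left_cancel (mul_left_cancel₀ he h)
  have hU : fixedPoints t q m = (fun v => ε * (1 + v)) '' (smallRoots (ε * t) q m \ {0}) ∪
      (fun v => -ε * (1 + v)) '' (smallRoots (-(ε * t)) q m \ {0}) := by
    ext s
    constructor
    · intro hs
      obtain ⟨e, he, v, hv, h0, rfl⟩ := exists_smallRoot_of_mem_fixedPoints hs
      by_cases h : e = ε
      · subst h
        exact Or.inl ⟨v, ⟨hv, h0⟩, rfl⟩
      · have h : e = -ε := by
          rcases hε with rfl | rfl <;> rcases he with rfl | rfl <;> simp_all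
        subst h
        rw [neg_mul] at hv
        exact Or.inr ⟨v, ⟨hv, h0⟩, rfl⟩
    · rintro (⟨v, hv, rfl⟩ | ⟨v, hv, rfl⟩)
      · exact one_add_mem_fixedPoints hp hε ht hv.1 hv.2
      · exact one_add_mem_fixedPoints hp hε' ht (by rw [neg_mul]; exact hv.1) hv.2
  have hdisj : Disjoint ((fun v => ε * (1 + v)) '' (smallRoots (ε * t) q m \ {0}))
      ((fun v => -ε * (1 + v)) '' (smallRoots (-(ε * t)) q m \ {0})) := by
    rw [Set.disjoint_left]
    rintro _ ⟨v, hv, rfl⟩ ⟨w, hw, h⟩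
    have h1 : (2 : ℚ_[p]) = -(v + w) := by
      refine mul_left_cancel₀ hε0 ?_
      simp only at h
      linear_combination -h
    have h2 := norm_add_lt_one hv.1.1 hw.1.1
    rw [← norm_neg, ← h1, norm_two_eq_one hp] at h2
    exact lt_irrefl _ h2
  rw [hU, Set.encard_union_eq hdisj, (hinj hε0).encard_image,
    (hinj (neg_ne_zero.2 hε0)).encard_image]

theorem cube_eq_of_vanishing {t q m s : ℚ_[p]} (hs : s ∈ fixedPoints t q m)
    (h : m * s ^ 3 + (q - m) = 0) : t ^ 3 = m * (q - m) * (3 * t - q) := by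
  have h1 : q - m - t = s * (t - m) := by
    refine mul_left_cancel₀ (ne_zero_of_mem_fixedPoints hs) ?_
    linear_combination (s + 1) * hs.1 - h
  linear_combination (t - m) ^ 2 * hs.1 - m * (q - m - t + s * (t - m)) * h1 * (-1) - t * (t - m) * h1

/-- Subtracting s + 1 times the quadratic from the cubic leaves s times a linear expression; for t ≠
m at most one s is lost. -/
theorem mul_eq_of_vanishing {t q m s : ℚ_[p]} (hs : s ∈ fixedPoints t q m) :
    m * s ^ 3 + (q - m) = 0 ↔ s * (t - m) = q - m - t := by
  have hs0 := ne_zero_of_mem_fixedPoints hs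
  constructor
  · intro h
    refine mul_left_cancel₀ hs0 ?_
    linear_combination h - (s + 1) * hs.1
  · intro h
    linear_combination s * h + (s + 1) * hs.1

theorem admissiblePoints_eq {t q m : ℚ_[p]}
    (h : ∀ s ∈ fixedPoints t q m, m * s ^ 3 + (q - m) ≠ 0) :
    admissiblePoints t q m = fixedPoints t q m :=
  Set.ext fun s => ⟨fun hs => hs.1, fun hs => ⟨hs, h s hs⟩⟩

/-- The exceptional equation says that the solution of the linear condition is also a root of the
quadratic, hence one of s₁, s₂; exactly that one is lost. -/
theorem encard_admissiblePoints_of_cube_eq {t q m : ℚ_[p]} (hm : m ≠ 0)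
    (h2 : (fixedPoints t q m).encard = 2) (htm : t ≠ m)
    (h : t ^ 3 = m * (q - m) * (3 * t - q)) : (admissiblePoints t q m).encard = 1 := by
  obtain ⟨s₁, s₂, hne, hS⟩ := Set.encard_eq_two.1 h2
  have hs₁ : s₁ ∈ fixedPoints t q m := by rw [hS]; simp
  have hs₂ : s₂ ∈ fixedPoints t q m := by rw [hS]; simp
  have htm' : t - m ≠ 0 := sub_ne_zero.2 htm
  obtain ⟨s, hs⟩ : ∃ s, s * (t - m) = q - m - t := ⟨_, div_mul_cancel₀ _ htm'⟩
  have hroot : m * s ^ 2 - t * s + (q - m) = 0 := by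
    refine mul_left_cancel₀ (pow_ne_zero 2 htm') ?_
    linear_combination h + m * (q - m - t + s * (t - m)) * hs - t * (t - m) * hs
  have hsum : m * (s₁ + s₂) = t := by
    refine mul_left_cancel₀ (sub_ne_zero.2 hne) ?_
    linear_combination hs₁.1 - hs₂.1
  have hmem : s = s₁ ∨ s = s₂ := by
    have h3 : m * ((s - s₁) * (s - s₂)) = 0 := by
      linear_combination hroot - hs₁.1 + (s₁ - s) * hsum
    rcases mul_eq_zero.1 ((mul_eq_zero.1 h3).resolve_left hm) with h4 | h4
    · exact Or.inl (sub_eq_zero.1 h4)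
    · exact Or.inr (sub_eq_zero.1 h4)
  have hvan : ∀ s' ∈ fixedPoints t q m, m * s' ^ 3 + (q - m) = 0 ↔ s' = s := by
    intro s' hs'
    rw [mul_eq_of_vanishing hs', ← hs]
    exact ⟨fun h => mul_right_cancel₀ htm' h, fun h => by rw [h]⟩
  rw [Set.encard_eq_one]
  have hadm : ∀ s', s' ∈ admissiblePoints t q m ↔ (s' = s₁ ∨ s' = s₂) ∧ s' ≠ s := by
    intro s'
    constructor
    · intro h
      exact ⟨by simpa [hS] using h.1, fun h0 => h.2 ((hvan s' h.1).2 h0)⟩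
    · rintro ⟨h, h0⟩
      have h' : s' ∈ fixedPoints t q m := by rw [hS]; exact h
      exact ⟨h', fun h1 => h0 ((hvan s' h').1 h1)⟩
  rcases hmem with rfl | rfl
  · refine ⟨s₂, Set.ext fun s' => ?_⟩
    rw [hadm, Set.mem_singleton_iff]
    exact ⟨fun h => h.1.resolve_left h.2, fun h => ⟨Or.inr h, h ▸ hne.symm⟩⟩
  · refine ⟨s₁, Set.ext fun s' => ?_⟩
    rw [hadm, Set.mem_singleton_iff]
    exact ⟨fun h => h.1.resolve_right h.2, fun h => ⟨Or.inl h, h ▸ hne⟩⟩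

end FixedPointCount

end PadicPotts

namespace PadicPotts

/-! ### Number of fixed points in each norm regime -/

section Count

variable {p : ℕ} [hpp : Fact p.Prime] {t q m : ℚ_[p]}

/-- Here |2m ∓ t| = |m| exceeds the constant term, so each sign has exactly one small root, nonzero
because q ≠ ±t. -/
theorem encard_fixedPoints_of_lt (hp : p ≠ 2) (hmax : max ‖t‖ ‖q‖ < ‖m‖) (ht : t ≠ 0)
    (h1 : q ≠ t) (h2 : q ≠ -t) : (fixedPoints t q m).encard = 2 := by
  obtain ⟨htm, hqm⟩ := max_lt_iff.1 hmax
  rw [encard_fixedPoints hp (Or.inl rfl) ht, one_mul]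
  have key : ∀ u : ℚ_[p], ‖u‖ < ‖m‖ → q ≠ u → (smallRoots u q m \ {0}).encard = 1 := by
    intro u hu hqu
    have h3 : ‖2 * m - u‖ = ‖m‖ := by
      rw [norm_sub_eq_left (by rwa [norm_two_mul hp]), norm_two_mul hp]
    exact encard_smallRoots_of_ne h3.ge (h3.symm ▸ norm_sub_lt hqm hu) hqu
  rw [key t htm h1, key (-t) (by rwa [norm_neg]) h2]
  rfl

theorem encard_fixedPoints_of_lt_of_eq (hp : p ≠ 2) (hmax : max ‖t‖ ‖q‖ < ‖m‖) (ht : t ≠ 0)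
    {ε : ℚ_[p]} (hε : ε = 1 ∨ ε = -1) (h : q = ε * t) : (fixedPoints t q m).encard = 1 := by
  obtain ⟨htm, hqm⟩ := max_lt_iff.1 hmax
  have hq : q ≠ 0 := by
    rw [h]
    refine mul_ne_zero ?_ ht
    rcases hε with rfl | rfl <;> norm_num
  have key : ∀ u : ℚ_[p], ‖u‖ < ‖m‖ → ‖2 * m - u‖ = ‖m‖ := fun u hu => by
    rw [norm_sub_eq_left (by rwa [norm_two_mul hp]), norm_two_mul hp]
  rw [encard_fixedPoints hp hε ht, ← h]
  have h1 := key q hqm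
  have h2 := key (-q) (by rwa [norm_neg])
  rw [encard_smallRoots_of_eq h1.ge (by
      rw [h1, sub_self, norm_zero]
      exact (norm_nonneg _).trans_lt hqm) rfl,
    encard_smallRoots_of_ne h2.ge (h2.symm ▸ norm_sub_lt hqm (by rwa [norm_neg]))
      (fun h0 => hq (self_eq_neg.1 h0)), zero_add]

/-- If `‖t‖ = ‖q‖ ≥ ‖m‖`, only one of the two signs contributes. -/
theorem encard_fixedPoints_of_norm_sub_lt (hp : p ≠ 2) (ht : t ≠ 0) (hmq : ‖m‖ ≤ ‖q‖)
    {ε : ℚ_[p]} (hε : ε = 1 ∨ ε = -1) (h : ‖q - ε * t‖ < ‖q‖) :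
    (fixedPoints t q m).encard = (smallRoots (ε * t) q m \ {0}).encard := by
  have h1 : ‖q - -(ε * t)‖ = ‖q‖ := by
    rw [show q - -(ε * t) = 2 * q - (q - ε * t) by ring,
      norm_sub_eq_left (by rwa [norm_two_mul hp]), norm_two_mul hp]
  have hεt : ‖ε * t‖ ≤ ‖q‖ := by
    rw [show ε * t = q - (q - ε * t) by ring, norm_sub_eq_left h]
  have h2 : smallRoots (-(ε * t)) q m = ∅ := by
    refine smallRoots_eq_empty (h1.symm ▸ hmq) ?_ ?_
    · rw [h1, sub_neg_eq_add]
      exact (IsUltrametricDist.norm_add_le_max _ _).trans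
        (max_le (by rwa [norm_two_mul hp]) hεt)
    · rw [← sub_ne_zero, ← norm_pos_iff, h1]
      exact (norm_nonneg _).trans_lt h
  rw [encard_fixedPoints hp hε ht, h2, Set.empty_sdiff, Set.encard_empty, add_zero]

/-- Factor q² - t² = (q - t)(q + t): some factor has norm less than |q|. -/
theorem exists_norm_sub_lt_of_close (h : ‖t ^ 2 - q ^ 2‖ < ‖q ^ 2‖) :
    ∃ ε : ℚ_[p], (ε = 1 ∨ ε = -1) ∧ ‖q - ε * t‖ < ‖q‖ := by
  by_contra! hc
  have h1 := hc 1 (Or.inl rfl)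
  have h2 := hc (-1) (Or.inr rfl)
  rw [← norm_neg, show -(t ^ 2 - q ^ 2) = (q - 1 * t) * (q - -1 * t) by ring, norm_mul, norm_pow,
    sq] at h
  exact absurd h (not_lt.2 (mul_le_mul h1 h2 (norm_nonneg _) (norm_nonneg _)))

theorem ne_sign_mul_of_close (h : 0 < ‖t ^ 2 - q ^ 2‖) {ε : ℚ_[p]} (hε : ε = 1 ∨ ε = -1) :
    q ≠ ε * t := by
  intro h0
  rw [norm_pos_iff] at h
  refine h ?_
  rw [h0]
  rcases hε with rfl | rfl <;> ring

theorem sign_mul_sq {ε : ℚ_[p]} (hε : ε = 1 ∨ ε = -1) : (ε * t) ^ 2 = t ^ 2 := by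
  rcases hε with rfl | rfl <;> ring

theorem encard_fixedPoints_of_close (hp : p ≠ 2) (ht : t ≠ 0) (hmq : ‖m‖ ≤ ‖q‖)
    (h0 : 0 < ‖t ^ 2 - q ^ 2‖) (h : ‖t ^ 2 - q ^ 2‖ < ‖q ^ 2‖) (h2 : ‖q - 2 * m‖ = ‖q‖) :
    (fixedPoints t q m).encard = 1 := by
  obtain ⟨ε, hε, h1⟩ := exists_norm_sub_lt_of_close h
  rw [encard_fixedPoints_of_norm_sub_lt hp ht hmq hε h1]
  have h3 : ‖2 * m - ε * t‖ = ‖q‖ := by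
    rw [← norm_neg, show -(2 * m - ε * t) = (q - 2 * m) - (q - ε * t) by ring,
      norm_sub_eq_left (by rwa [h2]), h2]
  exact encard_smallRoots_of_ne (by rwa [h3]) (by rwa [h3]) (ne_sign_mul_of_close h0 hε)

theorem norm_two_mul_sub_lt {ε : ℚ_[p]} (h1 : ‖q - ε * t‖ < ‖q‖) (h2 : ‖q - 2 * m‖ < ‖q‖) :
    ‖2 * m - ε * t‖ < ‖q‖ := by
  rw [show 2 * m - ε * t = (q - ε * t) - (q - 2 * m) by ring]
  exact norm_sub_lt h1 h2

theorem encard_fixedPoints_of_disc (hp : p ≠ 2) (ht : t ≠ 0) (hmq : ‖m‖ = ‖q‖)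
    (h0 : 0 < ‖t ^ 2 - q ^ 2‖) (h : ‖t ^ 2 - q ^ 2‖ < ‖q ^ 2‖) (h2 : ‖q - 2 * m‖ < ‖q‖)
    (hD : t ^ 2 - 4 * m * (q - m) ≠ 0) (hsq : IsSquare (t ^ 2 - 4 * m * (q - m))) :
    (fixedPoints t q m).encard = 2 := by
  obtain ⟨ε, hε, h1⟩ := exists_norm_sub_lt_of_close h
  rw [encard_fixedPoints_of_norm_sub_lt hp ht hmq.le hε h1]
  rw [← sign_mul_sq hε] at hD hsq
  exact encard_smallRoots_of_disc (hmq ▸ norm_two_mul_sub_lt h1 h2) (hmq ▸ h1)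
    (ne_sign_mul_of_close h0 hε) hD hsq

theorem encard_fixedPoints_of_disc_eq_zero (hp : p ≠ 2) (ht : t ≠ 0) (hmq : ‖m‖ = ‖q‖)
    (h0 : 0 < ‖t ^ 2 - q ^ 2‖) (h : ‖t ^ 2 - q ^ 2‖ < ‖q ^ 2‖) (h2 : ‖q - 2 * m‖ < ‖q‖)
    (hD : t ^ 2 - 4 * m * (q - m) = 0) : (fixedPoints t q m).encard = 1 := by
  obtain ⟨ε, hε, h1⟩ := exists_norm_sub_lt_of_close h
  rw [encard_fixedPoints_of_norm_sub_lt hp ht hmq.le hε h1]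
  rw [← sign_mul_sq hε] at hD
  exact encard_smallRoots_of_disc_eq_zero (hmq ▸ norm_two_mul_sub_lt h1 h2) (hmq ▸ h1)
    (ne_sign_mul_of_close h0 hε) hD

theorem encard_fixedPoints_of_eq (hp : p ≠ 2) (ht : t ≠ 0) (hq : q ≠ 0) (hmq : ‖m‖ = ‖q‖)
    {ε : ℚ_[p]} (hε : ε = 1 ∨ ε = -1) (h : q = ε * t) (h2 : ‖q - 2 * m‖ < ‖q‖)
    (h3 : q ≠ 2 * m) : (fixedPoints t q m).encard = 1 := by
  rw [encard_fixedPoints_of_norm_sub_lt hp ht hmq.le hε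
    (by rw [← h, sub_self, norm_zero]; exact norm_pos_iff.2 hq), ← h]
  exact encard_smallRoots_self (hmq ▸ h2) h3

/-- With s = ε(1 + v) the expression is q or q - 2m, both of norm |q|, plus a term of smaller norm.
-/
theorem not_vanishing_of_norm_eq (hq : q ≠ 0) (hmq : ‖m‖ ≤ ‖q‖) (h2 : ‖q - 2 * m‖ = ‖q‖)
    {s : ℚ_[p]} (hs : s ∈ fixedPoints t q m) : m * s ^ 3 + (q - m) ≠ 0 := by
  obtain ⟨ε, hε, v, hv, -, rfl⟩ := exists_smallRoot_of_mem_fixedPoints hs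
  have hq0 := norm_pos_iff.2 hq
  have h1 : ‖q + (ε - 1) * m‖ = ‖q‖ := by
    rcases hε with rfl | rfl
    · rw [sub_self, zero_mul, add_zero]
    · rw [← h2]
      congr 1
      ring
  have hε1 : ‖ε‖ = 1 := by rcases hε with rfl | rfl <;> simp
  have h3 : m * (ε * (1 + v)) ^ 3 + (q - m) =
      (q + (ε - 1) * m) + m * (ε * (v * (3 + 3 * v + v ^ 2))) := by
    rcases hε with rfl | rfl <;> ring
  have h4 : ‖3 + 3 * v + v ^ 2‖ ≤ 1 := by
    have h5 : ‖(3 : ℚ_[p])‖ ≤ 1 := by exact_mod_cast Padic.norm_int_le_one (p := p) 3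
    refine (IsUltrametricDist.norm_add_le_max _ _).trans (max_le
      ((IsUltrametricDist.norm_add_le_max _ _).trans (max_le h5 ?_)) ?_)
    · rw [norm_mul]
      exact mul_le_one₀ h5 (norm_nonneg _) hv.1.le
    · rw [norm_pow]
      exact pow_le_one₀ (norm_nonneg _) hv.1.le
  rw [h3, ← norm_pos_iff, norm_add_eq_left, h1]
  · exact hq0
  · rw [h1, norm_mul, norm_mul, hε1, one_mul, norm_mul]
    have h5 : ‖v‖ * ‖3 + 3 * v + v ^ 2‖ < 1 :=
      (mul_le_of_le_one_right (norm_nonneg _) h4).trans_lt hv.1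
    exact (mul_le_mul_of_nonneg_right hmq (by positivity)).trans_lt
      (mul_lt_of_lt_one_right hq0 h5)

theorem inv_le_norm_three (hp : p ≠ 2) : (p : ℝ)⁻¹ ≤ ‖(3 : ℚ_[p])‖ := by
  by_cases h : p = 3
  · subst h
    have := Padic.norm_p (p := 3)
    exact_mod_cast this.ge
  · have h1 : ¬ ((p : ℤ) ∣ 3) := by
      intro h1
      have h2 : p ∣ 3 := by exact_mod_cast h1
      exact h ((Nat.prime_dvd_prime_iff_eq hpp.out Nat.prime_three).1 h2)
    have h2 := (Padic.norm_intCast_lt_one_iff (p := p) (k := 3)).not.2 h1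
    push_cast at h2
    exact (inv_le_one_of_one_le₀ (by exact_mod_cast hpp.out.one_le)).trans (not_lt.1 h2)

/-- There are no nontrivial cube roots of unity close to `1`. -/
theorem eq_one_of_cube_eq_one (hp : p ≠ 2) {z : ℚ_[p]} (hz : ‖z - 1‖ < 1) (h : z ^ 3 = 1) :
    z = 1 := by
  by_contra hne
  have hp1 : (1 : ℝ) < p := by exact_mod_cast hpp.out.one_lt
  -- From z² + z + 1 = 0 follows |3| = |z - 1|² ≤ p⁻² < p⁻¹, impossible even for p = 3.
  have h1 : 3 * z = -(z - 1) ^ 2 := by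
    refine mul_left_cancel₀ (sub_ne_zero.2 hne) ?_
    linear_combination h
  have h2 := congrArg norm h1
  rw [norm_mul, norm_eq_one_of_norm_sub_one_lt hz, mul_one, norm_neg, norm_pow] at h2
  have h3 := inv_le_norm_three (p := p) hp
  have h4 := norm_le_inv_of_norm_lt_one hz
  have h5 : ‖z - 1‖ ^ 2 ≤ (p : ℝ)⁻¹ ^ 2 := pow_le_pow_left₀ (norm_nonneg _) h4 2
  have h6 : (p : ℝ)⁻¹ ^ 2 < (p : ℝ)⁻¹ :=
    pow_lt_self_of_lt_one₀ (by positivity) (inv_lt_one_of_one_lt₀ hp1) (by norm_num)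
  linarith

/-- Vanishing means s³ = -1, so s² would be a nontrivial cube root of unity near 1. -/
theorem not_vanishing_of_eq_two_mul (hp : p ≠ 2) (hm : m ≠ 0) (hq : q = 2 * m) {s : ℚ_[p]}
    (hs : s ∈ fixedPoints t q m) : m * s ^ 3 + (q - m) ≠ 0 := by
  intro h
  have h1 : s ^ 3 = -1 := by
    refine mul_left_cancel₀ hm ?_
    rw [hq] at h
    linear_combination h
  refine hs.2.2.1 (eq_one_of_cube_eq_one hp hs.2.1 ?_)
  linear_combination (s ^ 3 - 1) * h1

/-- The possible parameters of a fixed point. -/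
theorem cases_of_mem_fixedPoints (hp : p ≠ 2) (hm : m ≠ 0) (hq : q ≠ 0) {s : ℚ_[p]}
    (hs : s ∈ fixedPoints t q m) :
    max ‖t‖ ‖q‖ < ‖m‖ ∨
    (‖t‖ = ‖q‖ ∧ ‖m‖ = ‖q‖ ∧ (t = q ∨ t = -q) ∧ q ≠ 2 * m ∧ ‖q - 2 * m‖ < ‖q‖) ∨
    (‖t‖ = ‖q‖ ∧ (0 < ‖t ^ 2 - q ^ 2‖ ∧ ‖t ^ 2 - q ^ 2‖ < ‖q ^ 2‖) ∧
      (‖m‖ < ‖q‖ ∨ ‖m‖ = ‖q‖ ∧ (‖q - 2 * m‖ = ‖q‖ ∨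
        ‖q - 2 * m‖ < ‖q‖ ∧ IsSquare (t ^ 2 - 4 * m * (q - m))))) := by
  obtain ⟨ε, hε, v, hv, hv0, rfl⟩ := exists_smallRoot_of_mem_fixedPoints hs
  rw [or_iff_not_imp_left, not_lt]
  intro hmax
  have hq0 := norm_pos_iff.2 hq
  have hε1 : ‖ε * t‖ = ‖t‖ := by rcases hε with rfl | rfl <;> simp
  have hε2 := sign_mul_sq (t := t) hε
  by_cases hqt : q = ε * t
  · have htq : ‖t‖ = ‖q‖ := by rw [hqt, hε1]
    rw [htq, max_self] at hmax
    have h1 : m * v = q - 2 * m := by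
      refine mul_left_cancel₀ hv0 ?_
      linear_combination hv.2 - (1 + v) * hqt
    have h2 : ‖q - 2 * m‖ < ‖m‖ := by
      rw [← h1, norm_mul]
      exact mul_lt_of_lt_one_right (norm_pos_iff.2 hm) hv.1
    refine Or.inl ⟨htq, ?_, ?_, ?_, h2.trans_le hmax⟩
    · rw [show q = 2 * m + (q - 2 * m) by ring,
        norm_add_eq_left (by rwa [norm_two_mul hp]), norm_two_mul hp]
    · rcases hε with rfl | rfl
      · exact Or.inl (by rw [hqt, one_mul])
      · exact Or.inr (by rw [hqt, neg_one_mul, neg_neg])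
    · rw [← sub_ne_zero, ← h1]
      exact mul_ne_zero hm hv0
  -- Otherwise the constant term would dominate and there would be no small root.
  · have h1 : ‖q - ε * t‖ < max ‖t‖ ‖q‖ := by
      by_contra h1
      rw [not_lt] at h1
      refine Set.notMem_empty v ((smallRoots_eq_empty (hmax.trans h1) ?_ hqt) ▸ hv)
      refine le_trans ?_ h1
      rw [sub_eq_add_neg]
      refine (IsUltrametricDist.norm_add_le_max _ _).trans (max_le ?_ ?_)
      · rwa [norm_two_mul hp]
      · rw [norm_neg, hε1]
        exact le_max_left _ _
    have htq : ‖t‖ = ‖q‖ := by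
      by_contra hne
      rw [sub_eq_add_neg, IsUltrametricDist.norm_add_eq_max_of_norm_ne_norm
        (by rw [norm_neg, hε1]; exact Ne.symm hne), norm_neg, hε1, max_comm] at h1
      exact lt_irrefl _ h1
    rw [htq, max_self] at hmax h1
    have h2 : ‖q + ε * t‖ = ‖q‖ := by
      rw [show q + ε * t = 2 * q - (q - ε * t) by ring,
        norm_sub_eq_left (by rwa [norm_two_mul hp]), norm_two_mul hp]
    have h3 : ‖t ^ 2 - q ^ 2‖ = ‖q - ε * t‖ * ‖q‖ := by
      rw [← h2, ← norm_mul, ← hε2, ← norm_neg]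
      congr 1
      ring
    refine Or.inr ⟨htq, ⟨?_, ?_⟩, ?_⟩
    · rw [h3]
      exact mul_pos (norm_pos_iff.2 (sub_ne_zero.2 hqt)) hq0
    · rw [h3, norm_pow, sq]
      exact mul_lt_mul_of_pos_right h1 hq0
    · refine hmax.lt_or_eq.imp_right fun hmq => ⟨hmq, ?_⟩
      have h4 : ‖q - 2 * m‖ ≤ ‖q‖ := by
        rw [sub_eq_add_neg]
        exact (IsUltrametricDist.norm_add_le_max _ _).trans
          (max_le le_rfl (by rw [norm_neg, norm_two_mul hp, hmq]))
      refine h4.eq_or_lt.imp_right fun h5 => ⟨h5, ?_⟩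
      have h6 := (mem_smallRoots_iff_of_norm_lt (hmq ▸ norm_two_mul_sub_lt h1 h5)
        (hmq ▸ h1)).1 hv
      rw [hε2] at h6
      exact ⟨_, h6.symm.trans (sq _)⟩

end Count

/-! ### Matching the regimes with conditions 1 and 2 -/

section Classification

variable {p : ℕ} [hpp : Fact p.Prime] {θ : ℚ_[p]} {q m : ℕ}

theorem isSpecial_iff : IsSpecial θ q ↔ ∃ ε : ℚ_[p], (ε = 1 ∨ ε = -1) ∧ (q : ℚ_[p]) = ε * (θ - 1) := by
  constructor
  · rintro (h | h)
    · exact ⟨-1, Or.inr rfl, by rw [h]; ring⟩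
    · exact ⟨1, Or.inl rfl, by rw [h]; ring⟩
  · rintro ⟨ε, rfl | rfl, h⟩
    · exact Or.inr (by rw [h]; ring)
    · exact Or.inl (by rw [h]; ring)

theorem cond_of_mem_fixedPoints (hp : p ≠ 2) (hm : m ≠ 0) (hq : q ≠ 0) {s : ℚ_[p]}
    (hs : s ∈ fixedPoints (θ - 1) (q : ℚ_[p]) m) : Cond1 θ q m ∨ Cond2 θ q m := by
  have hm0 : (m : ℚ_[p]) ≠ 0 := by exact_mod_cast hm
  have hq0 : (q : ℚ_[p]) ≠ 0 := by exact_mod_cast hq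
  rcases cases_of_mem_fixedPoints hp hm0 hq0 hs with h | ⟨h1, h2, h3, h4, h5⟩ | ⟨h1, h2, h3⟩
  · by_cases hsp : IsSpecial θ q
    · exact Or.inr (Or.inl ⟨h, hsp⟩)
    · exact Or.inl (Or.inl ⟨h, hsp, sub_ne_zero.1 hs.2.2.2⟩)
  · refine Or.inr (Or.inr (Or.inr (Or.inr (Or.inl ⟨⟨h2.trans h1.symm, h1⟩, ?_,
      norm_pos_iff.2 (sub_ne_zero.2 h4), h5⟩))))
    rcases h3 with h3 | h3
    · exact Or.inr (by linear_combination h3)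
    · exact Or.inl (by linear_combination h3)
  · rcases h3 with h3 | ⟨h3, h4 | ⟨h4, h5⟩⟩
    · exact Or.inr (Or.inr (Or.inl ⟨⟨h1.symm ▸ h3, h1⟩, h2⟩))
    · exact Or.inr (Or.inr (Or.inr (Or.inl ⟨⟨h3.trans h1.symm, h1⟩, h2, h4⟩)))
    · by_cases hqm : q = 2 * m
      · have hqm' : (q : ℚ_[p]) = 2 * m := by exact_mod_cast hqm
        refine Or.inr (Or.inr (Or.inr (Or.inr (Or.inr (Or.inl ⟨hqm, h1, h2, ?_⟩)))))
        convert h5 using 1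
        rw [hqm']
        ring
      · have hqm' : (q : ℚ_[p]) ≠ 2 * m := by exact_mod_cast hqm
        have h6 := norm_pos_iff.2 (sub_ne_zero.2 hqm')
        by_cases hD : disc θ q m = 0
        · exact Or.inr (Or.inr (Or.inr (Or.inr (Or.inr (Or.inr
            ⟨⟨h3.trans h1.symm, h1⟩, h2, ⟨h6, h4⟩, hD⟩)))))
        · exact Or.inl (Or.inr ⟨⟨h3.trans h1.symm, h1⟩, h2, ⟨h6, h4⟩, hD, h5⟩)

theorem ne_two_mul_of_norm_lt (hp : p ≠ 2) {a b : ℚ_[p]} (h : ‖a‖ < ‖b‖) : a ≠ 2 * b := by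
  rintro rfl
  rw [norm_two_mul hp] at h
  exact lt_irrefl _ h

theorem natCast_eq_two_mul_iff : (q : ℚ_[p]) = 2 * m ↔ q = 2 * m := by
  norm_cast

theorem ne_two_mul_of_norm_sub_pos (h : 0 < ‖(q : ℚ_[p]) - 2 * m‖) : q ≠ 2 * m := fun h0 =>
  norm_pos_iff.1 h (sub_eq_zero.2 (natCast_eq_two_mul_iff.2 h0))

theorem sub_one_ne_zero_of_norm_eq (hq : q ≠ 0) (h : ‖θ - 1‖ = ‖(q : ℚ_[p])‖) : θ - 1 ≠ 0 := by
  rw [← norm_pos_iff, h, norm_pos_iff]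
  exact_mod_cast hq

theorem encard_fixedPoints_of_cond1 (hp : p ≠ 2) (hm : m ≠ 0) (hq : q ≠ 0) (h : Cond1 θ q m) :
    q ≠ 2 * m ∧ (fixedPoints (θ - 1) (q : ℚ_[p]) m).encard = 2 ∧
      (IsExceptional θ q m → θ - 1 ≠ m) := by
  have hm0 : (m : ℚ_[p]) ≠ 0 := by exact_mod_cast hm
  rcases h with ⟨hmax, hsp, h1⟩ | ⟨⟨h1, h2⟩, ⟨h3, h4⟩, ⟨h5, h6⟩, hD, hsq⟩
  · obtain ⟨htm, hqm⟩ := max_lt_iff.1 hmax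
    refine ⟨fun h0 => ne_two_mul_of_norm_lt hp hqm (natCast_eq_two_mul_iff.2 h0), ?_, ?_⟩
    · refine encard_fixedPoints_of_lt hp hmax (sub_ne_zero.2 h1) (fun h0 => hsp ?_)
        (fun h0 => hsp ?_)
      · exact Or.inr (by rw [h0]; ring)
      · exact Or.inl (by rw [h0]; ring)
    · intro _ h0
      rw [h0] at htm
      exact lt_irrefl _ htm
  · have hqm := ne_two_mul_of_norm_sub_pos h5
    refine ⟨hqm, encard_fixedPoints_of_disc hp (sub_one_ne_zero_of_norm_eq hq h2) (h1.trans h2)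
      h3 h4 h6 hD hsq, fun hex h0 => hqm ((natCast_eq_two_mul_iff (p := p)).1 ?_)⟩
    -- For θ - 1 = m the exceptional equation reduces to m (q - 2m)² = 0.
    rw [IsExceptional, h0] at hex
    rw [← sub_eq_zero, ← sq_eq_zero_iff]
    refine mul_left_cancel₀ hm0 ?_
    linear_combination hex

theorem encard_admissiblePoints_of_cond2 (hp : p ≠ 2) (hm : m ≠ 0) (hq : q ≠ 0)
    (h : Cond2 θ q m) :
    (q ≠ 2 * m ∧ (admissiblePoints (θ - 1) (q : ℚ_[p]) m).encard = 1) ∨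
      (q = 2 * m ∧ (admissiblePoints (θ - 1) (q : ℚ_[p]) m).Nonempty) := by
  have hm0 : (m : ℚ_[p]) ≠ 0 := by exact_mod_cast hm
  have hq0 : (q : ℚ_[p]) ≠ 0 := by exact_mod_cast hq
  have hqn := norm_pos_iff.2 hq0
  rcases h with ⟨hmax, hsp⟩ | ⟨⟨h1, h2⟩, h3, h4⟩ | ⟨⟨h1, h2⟩, ⟨h3, h4⟩, h5⟩ |
    ⟨⟨h1, h2⟩, hsp, h3, h4⟩ | ⟨h1, h2, ⟨h3, h4⟩, hsq⟩ | ⟨⟨h1, h2⟩, ⟨h3, h4⟩, ⟨h5, h6⟩, hD⟩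
  · obtain ⟨htm, hqm⟩ := max_lt_iff.1 hmax
    obtain ⟨ε, hε, h⟩ := isSpecial_iff.1 hsp
    have ht : θ - 1 ≠ 0 := right_ne_zero_of_mul (h ▸ hq0)
    refine Or.inl ⟨fun h0 => ne_two_mul_of_norm_lt hp hqm (natCast_eq_two_mul_iff.2 h0), ?_⟩
    rw [admissiblePoints_eq, encard_fixedPoints_of_lt_of_eq hp hmax ht hε h]
    intro s hs hvan
    have h1 := cube_eq_of_vanishing hs hvan
    have h2 : ‖(q : ℚ_[p]) - m‖ = ‖(m : ℚ_[p])‖ := by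
      rw [← norm_neg, neg_sub, norm_sub_eq_left hqm]
    -- Case 2a: with t = ±q the exceptional equation becomes q² = 2m(q - m) or q² = 4m(q - m), whose
    -- right side has norm |m|² > |q|².
    have h3 : (q : ℚ_[p]) ^ 2 = 2 * (m * (q - m)) ∨
        (q : ℚ_[p]) ^ 2 = 2 * (2 * (m * (q - m))) := by
      rcases hε with rfl | rfl
      · refine Or.inl (mul_left_cancel₀ hq0 ?_)
        rw [show θ - 1 = q by linear_combination -h] at h1
        linear_combination h1
      · refine Or.inr (mul_left_cancel₀ hq0 ?_)
        rw [show θ - 1 = -q by linear_combination h] at h1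
        linear_combination -h1
    have h4 : ‖(q : ℚ_[p])‖ ^ 2 = ‖(m : ℚ_[p])‖ ^ 2 := by
      rw [← norm_pow]
      rcases h3 with h3 | h3
      · rw [h3, norm_two_mul hp, norm_mul, h2, sq]
      · rw [h3, norm_two_mul hp, norm_two_mul hp, norm_mul, h2, sq]
    exact (pow_lt_pow_left₀ hqm (norm_nonneg _) two_ne_zero).ne h4
  · have h5 : ‖(q : ℚ_[p]) - 2 * m‖ = ‖(q : ℚ_[p])‖ :=
      norm_sub_eq_left (by rwa [norm_two_mul hp, ← h2])
    have hmq : ‖(m : ℚ_[p])‖ ≤ ‖(q : ℚ_[p])‖ := h2 ▸ h1.le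
    refine Or.inl ⟨ne_two_mul_of_norm_sub_pos (h5.symm ▸ hqn), ?_⟩
    rw [admissiblePoints_eq fun s hs => not_vanishing_of_norm_eq hq0 hmq h5 hs,
      encard_fixedPoints_of_close hp (sub_one_ne_zero_of_norm_eq hq h2) hmq h3 h4 h5]
  · have hmq : ‖(m : ℚ_[p])‖ ≤ ‖(q : ℚ_[p])‖ := (h1.trans h2).le
    refine Or.inl ⟨ne_two_mul_of_norm_sub_pos (h5.symm ▸ hqn), ?_⟩
    rw [admissiblePoints_eq fun s hs => not_vanishing_of_norm_eq hq0 hmq h5 hs,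
      encard_fixedPoints_of_close hp (sub_one_ne_zero_of_norm_eq hq h2) hmq h3 h4 h5]
  · obtain ⟨ε, hε, h⟩ := isSpecial_iff.1 hsp
    have hqm := ne_two_mul_of_norm_sub_pos h3
    have hqm' : (q : ℚ_[p]) ≠ 2 * m := fun h0 => hqm (natCast_eq_two_mul_iff.1 h0)
    have hmq := h1.trans h2
    refine Or.inl ⟨hqm, ?_⟩
    rw [admissiblePoints_eq, encard_fixedPoints_of_eq hp (sub_one_ne_zero_of_norm_eq hq h2) hq0
      hmq hε h h4 hqm']
    intro s hs hvan
    have h5 := cube_eq_of_vanishing hs hvan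
    -- Case 2d: t = q gives 2m² = -(q - 2m)q, contradicting the norms; t = -q gives (q - 2m)² = 0.
    rcases hε with rfl | rfl
    · rw [show θ - 1 = q by linear_combination -h] at h5
      have h6 : 2 * (m : ℚ_[p]) ^ 2 = -((q - 2 * m) * q) := by
        refine mul_left_cancel₀ hq0 ?_
        linear_combination h5
      have h7 := congrArg norm h6
      rw [norm_two_mul hp, norm_neg, norm_mul, norm_pow, hmq, sq] at h7
      exact (mul_lt_mul_of_pos_right h4 hqn).ne' h7
    · rw [show θ - 1 = -q by linear_combination h] at h5
      refine hqm' (sub_eq_zero.1 (sq_eq_zero_iff.1 (mul_left_cancel₀ hq0 ?_)))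
      linear_combination -h5
  · have hqm : (q : ℚ_[p]) = 2 * m := natCast_eq_two_mul_iff.2 h1
    have hmq : ‖(m : ℚ_[p])‖ = ‖(q : ℚ_[p])‖ := by rw [hqm, norm_two_mul hp]
    have hD : (θ - 1) ^ 2 - (q : ℚ_[p]) ^ 2 = (θ - 1) ^ 2 - 4 * m * (q - m) := by
      rw [hqm]
      ring
    refine Or.inr ⟨h1, ?_⟩
    rw [admissiblePoints_eq fun s hs => not_vanishing_of_eq_two_mul hp hm0 hqm hs,
      ← Set.encard_ne_zero, encard_fixedPoints_of_disc hp (sub_one_ne_zero_of_norm_eq hq h2) hmq h3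
        h4 (by rwa [hqm, sub_self, norm_zero, ← hqm]) (hD ▸ norm_pos_iff.1 h3) (hD ▸ hsq)]
    norm_num
  · have ht := sub_one_ne_zero_of_norm_eq hq h2
    rw [disc] at hD
    refine Or.inl ⟨ne_two_mul_of_norm_sub_pos h5, ?_⟩
    rw [admissiblePoints_eq, encard_fixedPoints_of_disc_eq_zero hp ht (h1.trans h2) h3 h4 h6 hD]
    intro s hs hvan
    have h7 := cube_eq_of_vanishing hs hvan
    refine norm_pos_iff.1 h3 ?_
    -- Case 2f: inserting 4m(q - m) = t² into the exceptional equation gives t = -q, against t² ≠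
    -- q².
    have h8 : θ - 1 + q = 0 := by
      refine mul_left_cancel₀ (pow_ne_zero 2 ht) ?_
      linear_combination 4 * h7 - (3 * (θ - 1) - q) * hD
    linear_combination (θ - 1 - q) * h8

end Classification

end PadicPotts

/-! ### The classification theorem -/

open PadicPotts in
theorem theorem3 {p : ℕ} [Fact p.Prime] (hp : p ≠ 2)
    {V : Type*} (G : SimpleGraph V) (hG : G.IsTree) (hdeg : ∀ x, (G.neighborSet x).ncard = 3)
    (x₀ : V) (q m : ℕ) (hm : 1 ≤ m) (hmq : m ≤ q / 2)
    (J θ : ℚ_[p]) (hJ : ‖J‖ < expRadius p) (hθ : θ = NormedSpace.exp J) :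
    (Cond1 θ q m → ¬ IsExceptional θ q m →
      (tiGibbsMeasures G x₀ J q m).encard = ((2 * q.choose m : ℕ) : ℕ∞)) ∧
    (Cond1 θ q m → IsExceptional θ q m →
      (tiGibbsMeasures G x₀ J q m).encard = ((q.choose m : ℕ) : ℕ∞)) ∧
    (Cond2 θ q m →
      (tiGibbsMeasures G x₀ J q m).encard = ((q.choose m : ℕ) : ℕ∞)) ∧
    (¬ Cond1 θ q m → ¬ Cond2 θ q m →
      tiGibbsMeasures G x₀ J q m = ∅) := by
  have hq : q ≠ 0 := by omega
  have hm0 : m ≠ 0 := by omega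
  have hmq' : m < q := by omega
  have hJ1 := (norm_lt_expRadius_iff hp).1 hJ
  subst hθ
  refine ⟨fun h hex => ?_, fun h hex => ?_, fun h => ?_, fun h1 h2 => ?_⟩
  · obtain ⟨hqm, h2, -⟩ := encard_fixedPoints_of_cond1 hp hm0 hq h
    rw [encard_tiGibbsMeasures hp hG hdeg hm hmq' hJ1 hqm,
      admissiblePoints_eq fun s hs hvan => hex (cube_eq_of_vanishing hs hvan), h2]
    push_cast
    exact mul_comm _ _
  · obtain ⟨hqm, h2, h3⟩ := encard_fixedPoints_of_cond1 hp hm0 hq h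
    rw [encard_tiGibbsMeasures hp hG hdeg hm hmq' hJ1 hqm,
      encard_admissiblePoints_of_cube_eq (by exact_mod_cast hm0) h2 (h3 hex) hex, mul_one]
  · rcases encard_admissiblePoints_of_cond2 hp hm0 hq h with ⟨hqm, h1⟩ | ⟨hqm, h1⟩
    · rw [encard_tiGibbsMeasures hp hG hdeg hm hmq' hJ1 hqm, h1, mul_one]
    · exact encard_tiGibbsMeasures_two_mul hp hG hdeg hm hmq' hJ1 hqm h1
  · rw [Set.eq_empty_iff_forall_notMem]
    intro μ hμ
    obtain ⟨M, -, s, hs, -⟩ := (mem_tiGibbsMeasures_iff hp hG hdeg hm hmq' hJ1).1 hμ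
    exact (cond_of_mem_fixedPoints hp hm0 hq hs.1).elim h1 h2
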